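/- Let $n\ge 2$, $0<T<\infty$, let $M$ be a compact smooth manifold of dimension $n-1$, and let $\varphi^*:M\times[0,T)\to\mathbb{R}^n$ be a smooth map such that for every $t\in[0,T)$ the map $\varphi^*(\cdot,t)$ is a smooth embedding of $M$ onto the boundary of a smooth, strictly convex body (compact, convex, with positive definite second fundamental form of the boundary) that contains the origin in its interior. Let $\nu^*(\cdot,t)$ be the outer unit normal and $\mathcal K^*(\cdot,t)>0$ the Gauss curvature of this boundary, and suppose that on $M\times[0,T)$ $$\partial_t\varphi^*=\frac{\langle\varphi^*,\nu^*\rangle^{n+2}}{\|\varphi^*\|^{n}}\,\frac{1}{\mathcal K^*}\,\nu^* .$$ Assume that $\gamma\|\varphi^*\|\le\langle\varphi^*,\nu^*\rangle$ on $M\times[0,T)$ for some $0<\gamma\le 1$. For $\lambda\in\mathbb{R}$ put $$\chi_\lambda=\|\varphi^*\|^{n+1}-\lambda\,\frac{\langle\varphi^*,\nu^*\rangle^{n+2}}{\|\varphi^*\|^{n}}\,\frac1{\mathcal K^*},\qquad \Lambda(n,\gamma)=\left(\frac{2n^2+5n+2}{(n-1)\,\gamma^{\frac{4n+8}{n-1}+2n+4}}\right)^{n-1}.$$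 Then for every $\lambda\ge\Lambda(n,\gamma)$ such that $\chi_\lambda<0$ on $M$ at time $t=0$, one has $$\|\varphi^*\|^{n-1}\le\frac{\lambda}{\mathcal K^*}\qquad\text{on } M\times[0,T).$$ Moreover, such $\lambda$ exist; in particular there is $\lambda\ge\Lambda(n,\gamma)$ with $\|\varphi^*\|^{n-1}\le\lambda/\mathcal K^*$ on $M\times[0,T)$. -/

import Mathlib

open Set
open scoped Manifold ContDiff RealInnerProductSpace

noncomputable section

namespace DualFlow

variable {n : ℕ} {M : Type*} [TopologicalSpace M]
  [ChartedSpace (EuclideanSpace ℝ (Fin (n - 1))) M]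

/-- The differential at `x` of a map `f : M → ℝⁿ`, applied to a tangent vector `v`. -/
def diff (f : M → EuclideanSpace ℝ (Fin n)) (x : M)
    (v : TangentSpace (𝓡 (n - 1)) x) : EuclideanSpace ℝ (Fin n) :=
  mfderiv (𝓡 (n - 1)) 𝓘(ℝ, EuclideanSpace ℝ (Fin n)) f x v

/-- The `i`-th coordinate tangent vector at `x`. -/
def coordVec (x : M) (i : Fin (n - 1)) : TangentSpace (𝓡 (n - 1)) x :=
  (EuclideanSpace.single i (1 : ℝ) : EuclideanSpace ℝ (Fin (n - 1)))

/-- The matrix `g_ij = ⟨∂_i f, ∂_j f⟩` of the first fundamental form. -/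
def firstForm (f : M → EuclideanSpace ℝ (Fin n)) (x : M) : Matrix (Fin (n - 1)) (Fin (n - 1)) ℝ :=
  Matrix.of fun i j => ⟪diff f x (coordVec x i), diff f x (coordVec x j)⟫

/-- The matrix `h_ij = ⟨∂_i f, ∂_j ν⟩` of the second fundamental form with respect to the
unit normal `ν` (positive for the unit sphere with its outer normal). -/
def secondForm (f ν : M → EuclideanSpace ℝ (Fin n)) (x : M) : Matrix (Fin (n - 1)) (Fin (n - 1)) ℝ :=
  Matrix.of fun i j => ⟪diff f x (coordVec x i), diff ν x (coordVec x j)⟫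

/-- Gauss curvature `det h_ij / det g_ij`; the quotient does not depend on the coordinates. -/
def gaussCurvature (f ν : M → EuclideanSpace ℝ (Fin n)) (x : M) : ℝ :=
  (secondForm f ν x).det / (firstForm f x).det

/-- `f : M → ℝⁿ` is a smooth embedding of the (compact) manifold `M` onto the boundary of a
smooth, strictly convex body containing the origin in its interior, and `ν` is the outer unit
normal along `f`. Strict convexity means that the second fundamental form is positive definite.
(For compact `M` an injective immersion is an embedding.) -/
structure IsStrictlyConvexBoundary (f ν : M → EuclideanSpace ℝ (Fin n)) : Prop where
  smooth : ContMDiff (𝓡 (n - 1)) 𝓘(ℝ, EuclideanSpace ℝ (Fin n)) ∞ f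
  injective : Function.Injective f
  immersion : ∀ x, Function.Injective (mfderiv (𝓡 (n - 1)) 𝓘(ℝ, EuclideanSpace ℝ (Fin n)) f x)
  body : ∃ K : ConvexBody (EuclideanSpace ℝ (Fin n)),
    0 ∈ interior (K : Set (EuclideanSpace ℝ (Fin n))) ∧
    range f = frontier (K : Set (EuclideanSpace ℝ (Fin n))) ∧
    ∀ x, ‖ν x‖ = 1 ∧ ∀ y ∈ K, ⟪y - f x, ν x⟫ ≤ 0
  strictly_convex : ∀ x (v : TangentSpace (𝓡 (n - 1)) x), v ≠ 0 → 0 < ⟪diff f x v, diff ν x v⟫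

/-- The speed `(⟨f, ν⟩ ^ (n + 2) / ‖f‖ ^ n) * (1 / K)` of the dual flow. -/
def speed (f ν : M → EuclideanSpace ℝ (Fin n)) (x : M) : ℝ :=
  ⟪f x, ν x⟫ ^ (n + 2) / ‖f x‖ ^ n * (1 / gaussCurvature f ν x)

/-- `φ : M × [0, T) → ℝⁿ`, with outer unit normal `ν`, is a smooth solution of the dual flow
`∂_t φ = (⟨φ, ν⟩ ^ (n + 2) / ‖φ‖ ^ n) (1 / K) ν` by boundaries of smooth, strictly convex bodies
with the origin in their interior. At `t = 0` the time derivative is one-sided. -/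
structure IsDualFlow (T : ℝ) (φ ν : M → ℝ → EuclideanSpace ℝ (Fin n)) : Prop where
  smooth : ContMDiffOn ((𝓡 (n - 1)).prod 𝓘(ℝ, ℝ)) 𝓘(ℝ, EuclideanSpace ℝ (Fin n)) ∞
    (fun p : M × ℝ => φ p.1 p.2) (univ ×ˢ Ico 0 T)
  convex : ∀ t ∈ Ico 0 T, IsStrictlyConvexBoundary (fun x => φ x t) (fun x => ν x t)
  flow : ∀ t ∈ Ico 0 T, ∀ x, HasDerivWithinAt (fun τ => φ x τ)
    (speed (fun y => φ y t) (fun y => ν y t) x • ν x t) (Ico 0 T) t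

/-- `χ = ‖f‖ ^ (n + 1) - lam * (⟨f, ν⟩ ^ (n + 2) / ‖f‖ ^ n) * (1 / K)`. -/
def chi (lam : ℝ) (f ν : M → EuclideanSpace ℝ (Fin n)) (x : M) : ℝ :=
  ‖f x‖ ^ (n + 1) - lam * speed f ν x

/-- The constant `((2n² + 5n + 2) / ((n - 1) γ ^ ((4n + 8)/(n - 1) + 2n + 4))) ^ (n - 1)`. -/
def threshold (n : ℕ) (γ : ℝ) : ℝ :=
  ((2 * (n : ℝ) ^ 2 + 5 * n + 2) /
    (((n : ℝ) - 1) * γ ^ ((4 * (n : ℝ) + 8) / ((n : ℝ) - 1) + 2 * n + 4))) ^ (n - 1)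

end DualFlow

end

/-!
Maximum principle with an affine barrier. Let `S` be the speed, and let `p` be a first zero of
`χ_λ = ‖f‖ ^ (n + 1) - λ S`. The convex function `‖y‖ ^ (n + 1)` lies above its tangent plane at
`f p`, so `S - ⟪e, f⟫` has a minimum at `p` among nearby points at earlier times, where
`e = (n + 1) S(p) / ‖f p‖² • f p`. Hence, at `p`, the gradient of `S` equals that of `⟪e, f⟫`, its
Hessian dominates that of `⟪e, f⟫`, and its time derivative is at most that of `⟪e, f⟫`.

Differentiating the logarithm of `S ‖f‖ ^ n K = ⟪f, ν⟫ ^ (n + 2)` in time, where `∂ₜ log K` is the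
trace of `-Hess S` with respect to the second fundamental form, up to terms of first order and a
multiple of `S H`, turns these relations into the bound `H ⟪f, ν⟫ < n (n + 2)` on the mean
curvature `H`. By the inequality of arithmetic and geometric means
`K ≤ (H / (n - 1)) ^ (n - 1)`, and `γ ‖f‖ ≤ ⟪f, ν⟫` then bounds `λ = ‖f‖ ^ (n + 1) / S` strictly
below `Λ(n, γ)`.
-/

open Filter Topology Matrix

namespace DualFlow

section Matrices

variable {ι : Type*} [Fintype ι]

open scoped MatrixOrder in
theorem exists_eq_conjTranspose_mul_self {A : Matrix ι ι ℝ} (hA : A.PosSemidef) :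
    ∃ B : Matrix ι ι ℝ, A = Bᴴ * B := by
  classical exact CStarAlgebra.nonneg_iff_eq_star_mul_self.1 hA.nonneg

theorem trace_mul_nonneg {A B : Matrix ι ι ℝ} (hA : A.PosSemidef) (hB : B.PosSemidef) :
    0 ≤ (A * B).trace := by
  obtain ⟨C, rfl⟩ := exists_eq_conjTranspose_mul_self hA
  rw [Matrix.mul_assoc, Matrix.trace_mul_comm]
  exact (hB.mul_mul_conjTranspose_same C).trace_nonneg

variable [DecidableEq ι]

theorem hasDerivAt_det {𝕜 : Type*} [NontriviallyNormedField 𝕜] {A : 𝕜 → Matrix ι ι 𝕜}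
    {A' : Matrix ι ι 𝕜} {t : 𝕜} (hA : ∀ i j, HasDerivAt (fun s => A s i j) (A' i j) t) :
    HasDerivAt (fun s => (A s).det) (A' * (A t).adjugate).trace t := by
  let D : ContinuousMultilinearMap 𝕜 (fun _ : ι => ι → 𝕜) 𝕜 :=
    { (Matrix.detRowAlternating (R := 𝕜) (n := ι)).toMultilinearMap with
      cont := Continuous.matrix_det continuous_id }
  have hrows : HasDerivAt (fun s => (fun i => A s i : ι → ι → 𝕜)) (fun i => A' i) t :=
    hasDerivAt_pi.2 fun i => hasDerivAt_pi.2 fun j => hA i j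
  have hcramer : ∀ i, D (Function.update (A t) i (A' i)) = (A' * (A t).adjugate) i i := fun i =>
    calc D (Function.update (A t) i (A' i)) = ((A t).updateRow i (A' i)).det := rfl
      _ = (A' * (A t).adjugate) i i := by
        rw [← Matrix.cramer_transpose_apply, Matrix.cramer_eq_adjugate_mulVec,
          ← Matrix.adjugate_transpose, Matrix.mulVec_transpose]
        rfl
  exact ((D.hasFDerivAt (A t)).comp_hasDerivAt t hrows).congr_deriv
    ((D.linearDeriv_apply (A t) A').trans (Finset.sum_congr rfl fun i _ => hcramer i))

theorem logDeriv_det {𝕜 : Type*} [NontriviallyNormedField 𝕜] {A : 𝕜 → Matrix ι ι 𝕜}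
    {A' : Matrix ι ι 𝕜} {t : 𝕜} (hA : ∀ i j, HasDerivAt (fun s => A s i j) (A' i j) t) :
    logDeriv (fun s => (A s).det) t = ((A t)⁻¹ * A').trace := by
  rw [logDeriv_apply, (hasDerivAt_det hA).deriv, Matrix.inv_def, Ring.inverse_eq_inv',
    Matrix.smul_mul, Matrix.trace_smul, Matrix.trace_mul_comm, smul_eq_mul, div_eq_inv_mul]

theorem card_pow_mul_prod_le_sum_pow {α : Type*} (s : Finset α) {z : α → ℝ}
    (hz : ∀ i ∈ s, 0 ≤ z i) : (s.card : ℝ) ^ s.card * ∏ i ∈ s, z i ≤ (∑ i ∈ s, z i) ^ s.card := by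
  rcases s.eq_empty_or_nonempty with rfl | hs
  · simp
  have hcard : s.card ≠ 0 := Finset.card_ne_zero.2 hs
  have hmean := Real.geom_mean_le_arith_mean_weighted s (fun _ => (s.card : ℝ)⁻¹) z
    (fun _ _ => by positivity) (by simp [hcard]) hz
  have hpow := pow_le_pow_left₀ (Finset.prod_nonneg fun i hi => Real.rpow_nonneg (hz i hi) _)
    hmean s.card
  rwa [← Finset.prod_pow,
    Finset.prod_congr rfl fun i hi => Real.rpow_inv_natCast_pow (hz i hi) hcard,
    ← Finset.mul_sum, mul_pow, inv_pow, le_inv_mul_iff₀ (by positivity)] at hpow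

theorem card_pow_mul_det_le_trace_pow {A : Matrix ι ι ℝ} (hA : A.PosSemidef) :
    (Fintype.card ι : ℝ) ^ Fintype.card ι * A.det ≤ A.trace ^ Fintype.card ι := by
  rw [hA.1.trace_eq_sum_eigenvalues, hA.1.det_eq_prod_eigenvalues]
  exact card_pow_mul_prod_le_sum_pow Finset.univ fun i _ => hA.eigenvalues_nonneg i

theorem card_pow_mul_det_div_det_le_trace_pow {g h : Matrix ι ι ℝ} (hg : g.PosDef)
    (hh : h.PosSemidef) : (Fintype.card ι : ℝ) ^ Fintype.card ι * (h.det / g.det) ≤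
      (g⁻¹ * h).trace ^ Fintype.card ι := by
  obtain ⟨B, hB⟩ := exists_eq_conjTranspose_mul_self hg.inv.posSemidef
  have htrace : (g⁻¹ * h).trace = (B * h * Bᴴ).trace := by
    rw [hB, Matrix.mul_assoc, Matrix.trace_mul_comm]
  have hdet : h.det / g.det = (B * h * Bᴴ).det := by
    rw [div_eq_mul_inv, ← Ring.inverse_eq_inv', ← Matrix.det_nonsing_inv, hB, Matrix.det_mul,
      Matrix.det_mul, Matrix.det_mul]
    ring
  rw [htrace, hdet]
  exact card_pow_mul_det_le_trace_pow (hh.mul_mul_conjTranspose_same B)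

end Matrices

section FundamentalForms

variable {ι F E : Type*} [Fintype ι] [DecidableEq ι] [AddCommGroup F] [Module ℝ F]
  [NormedAddCommGroup E] [InnerProductSpace ℝ E]

/-- The bilinear form `(v, w) ↦ ⟪P v, Q w⟫`. If `P` and `Q` are the differentials of a
parametrized hypersurface and of its unit normal, then `pairing P P` and `pairing P Q` are the first
and the second fundamental form. -/
noncomputable def pairing (P Q : F →ₗ[ℝ] E) : LinearMap.BilinForm ℝ F :=
  (innerₗ E).compl₁₂ P Q

theorem pairing_apply (P Q : F →ₗ[ℝ] E) (v w : F) : pairing P Q v w = ⟪P v, Q w⟫ := rfl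

theorem posSemidef_toMatrix {B : LinearMap.BilinForm ℝ F} (b : Module.Basis ι ℝ F)
    (hB : B.IsSymm) (hnonneg : ∀ v, 0 ≤ B v v) : (B.toMatrix b).PosSemidef := by
  refine Matrix.PosSemidef.of_dotProduct_mulVec_nonneg ?_ fun x => ?_
  · ext i j
    rw [Matrix.conjTranspose_apply, star_trivial]
    simpa only [LinearMap.BilinForm.toMatrix_apply] using hB.eq (b j) (b i)
  · rw [star_trivial, LinearMap.BilinForm.dotProduct_toMatrix_mulVec]
    exact hnonneg _

theorem posDef_toMatrix_pairing (b : Module.Basis ι ℝ F) {P Q : F →ₗ[ℝ] E}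
    (hsymm : (pairing P Q).IsSymm) (hpos : ∀ v, v ≠ 0 → 0 < ⟪P v, Q v⟫) :
    ((pairing P Q).toMatrix b).PosDef :=
  (LinearMap.BilinForm.posDef_toQuadraticMap_iff_matrix b _ hsymm).1 hpos

theorem posDef_toMatrix_pairing_self (b : Module.Basis ι ℝ F) {P : F →ₗ[ℝ] E}
    (hP : Function.Injective P) : ((pairing P P).toMatrix b).PosDef :=
  posDef_toMatrix_pairing b ⟨fun v w => real_inner_comm (P w) (P v)⟩ fun _ hv =>
    real_inner_self_pos.2 ((map_ne_zero_iff P hP).2 hv)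

/-- The Gauss-Kronecker curvature `det h / det g` of the fundamental forms of `P` and `Q`. -/
noncomputable def gaussKronecker (b : Module.Basis ι ℝ F) (P Q : F →ₗ[ℝ] E) : ℝ :=
  ((pairing P Q).toMatrix b).det / ((pairing P P).toMatrix b).det

/-- The mean curvature `tr (g⁻¹ h)` of the fundamental forms of `P` and `Q`, not normalized by the
dimension. -/
noncomputable def meanCurvature (b : Module.Basis ι ℝ F) (P Q : F →ₗ[ℝ] E) : ℝ :=
  (((pairing P P).toMatrix b)⁻¹ * (pairing P Q).toMatrix b).trace

theorem gaussKronecker_comp (b : Module.Basis ι ℝ F) (P Q : F →ₗ[ℝ] E) {A : F →ₗ[ℝ] F}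
    (hA : Function.Bijective A) : gaussKronecker b (P ∘ₗ A) (Q ∘ₗ A) = gaussKronecker b P Q := by
  have hdet : LinearMap.det A ≠ 0 :=
    (LinearEquiv.isUnit_det' (LinearEquiv.ofBijective A hA)).ne_zero
  have hcomp : ∀ R : F →ₗ[ℝ] E, ((pairing (P ∘ₗ A) (R ∘ₗ A)).toMatrix b).det =
      LinearMap.det A ^ 2 * ((pairing P R).toMatrix b).det := fun R => by
    rw [← LinearMap.det_toMatrix b A,
      show pairing (P ∘ₗ A) (R ∘ₗ A) = (pairing P R).comp A A from rfl,
      LinearMap.BilinForm.toMatrix_comp b b, Matrix.det_mul, Matrix.det_mul, Matrix.det_transpose]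
    ring
  rw [gaussKronecker, hcomp, hcomp, mul_div_mul_left _ _ (pow_ne_zero 2 hdet), gaussKronecker]

theorem range_eq_orthogonal_span_singleton [FiniteDimensional ℝ E] {P : F →ₗ[ℝ] E} {ν : E}
    (hP : Function.Injective P) (hdim : Module.finrank ℝ E = Module.finrank ℝ F + 1) (hν : ν ≠ 0)
    (hperp : ∀ v, ⟪P v, ν⟫ = 0) : LinearMap.range P = (ℝ ∙ ν)ᗮ := by
  refine Submodule.eq_of_le_of_finrank_eq ?_ ?_
  · rintro _ ⟨v, rfl⟩
    exact Submodule.mem_orthogonal_singleton_iff_inner_left.2 (hperp v)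
  · have hsum := (ℝ ∙ ν).finrank_add_finrank_orthogonal
    rw [finrank_span_singleton hν] at hsum
    rw [LinearMap.finrank_range_of_inj hP]
    lia

theorem exists_comp_eq_of_range_le {P Q : F →ₗ[ℝ] E} (hP : Function.Injective P)
    (hQ : LinearMap.range Q ≤ LinearMap.range P) : ∃ A : F →ₗ[ℝ] F, P ∘ₗ A = Q := by
  refine ⟨(LinearEquiv.ofInjective P hP).symm ∘ₗ
    Q.codRestrict (LinearMap.range P) fun v => hQ ⟨v, rfl⟩, LinearMap.ext fun v => ?_⟩
  exact congrArg Subtype.val ((LinearEquiv.ofInjective P hP).apply_symm_apply _)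

theorem toMatrix_pairing_self_eq (b : Module.Basis ι ℝ F) {P Q : F →ₗ[ℝ] E}
    (hP : Function.Injective P) (hQ : LinearMap.range Q ≤ LinearMap.range P)
    (hsymm : (pairing P Q).IsSymm) :
    (pairing Q Q).toMatrix b = (pairing P Q).toMatrix b * ((pairing P P).toMatrix b)⁻¹ *
      (pairing P Q).toMatrix b := by
  -- The Weingarten map `A` with `Q = P ∘ A` has matrix `g⁻¹ h`.
  obtain ⟨A, rfl⟩ := exists_comp_eq_of_range_le hP hQ
  have hg := (posDef_toMatrix_pairing_self b hP).isUnit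
  have hflip : pairing (P ∘ₗ A) P = pairing P (P ∘ₗ A) := by
    ext v w
    exact (real_inner_comm _ _).trans (hsymm.eq w v)
  have hh : (pairing P (P ∘ₗ A)).toMatrix b =
      (LinearMap.toMatrix b b A)ᵀ * (pairing P P).toMatrix b := by
    rw [← hflip]
    exact LinearMap.BilinForm.toMatrix_compLeft b (pairing P P) A
  have hself : (pairing (P ∘ₗ A) (P ∘ₗ A)).toMatrix b =
      (LinearMap.toMatrix b b A)ᵀ * (pairing P (P ∘ₗ A)).toMatrix b :=
    LinearMap.BilinForm.toMatrix_compLeft b (pairing P (P ∘ₗ A)) A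
  rw [hself]
  nth_rewrite 2 [hh]
  rw [Matrix.mul_nonsing_inv_cancel_right _ _ ((Matrix.isUnit_iff_isUnit_det _).1 hg)]

theorem trace_inv_mul_sub_trace_inv_mul_le {g h k H : Matrix ι ι ℝ} (hh : h.PosDef)
    (hH : H.PosSemidef) (hk : k = h * g⁻¹ * h) (S c : ℝ) :
    (h⁻¹ * (S • k - H + c • h)).trace - (g⁻¹ * ((2 * S) • h)).trace ≤
      -S * (g⁻¹ * h).trace + Fintype.card ι * c := by
  have hdet : IsUnit h.det := isUnit_iff_ne_zero.2 hh.det_pos.ne'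
  have hweingarten : h⁻¹ * k = g⁻¹ * h := by
    rw [hk, Matrix.mul_assoc, Matrix.nonsing_inv_mul_cancel_left _ _ hdet]
  have htrace : 0 ≤ (h⁻¹ * H).trace := trace_mul_nonneg hh.inv.posSemidef hH
  rw [Matrix.mul_add, Matrix.mul_sub, Matrix.mul_smul, Matrix.mul_smul, Matrix.mul_smul,
    hweingarten, Matrix.nonsing_inv_mul _ hdet]
  simp only [Matrix.trace_add, Matrix.trace_sub, Matrix.trace_smul, Matrix.trace_one, smul_eq_mul]
  linarith

end FundamentalForms

section Calculus

variable {X Y : Type*} [NormedAddCommGroup X] [NormedSpace ℝ X] [NormedAddCommGroup Y]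
  [NormedSpace ℝ Y]

theorem eventually_differentiableAt {f : X → Y} {p : X} (hf : ContDiffAt ℝ 2 f p) :
    ∀ᶠ x in 𝓝 p, DifferentiableAt ℝ f x :=
  (hf.eventually (by simp)).mono fun _ hx => hx.differentiableAt (by simp)

theorem hasFDerivAt_fderiv {f : X → Y} {p : X} (hf : ContDiffAt ℝ 2 f p) :
    HasFDerivAt (fderiv ℝ f) (fderiv ℝ (fderiv ℝ f) p) p :=
  ((hf.fderiv_right (m := 1) (by norm_num)).differentiableAt (by simp)).hasFDerivAt

theorem hasFDerivAt_fderiv_apply {f : X → Y} {p : X} (hf : ContDiffAt ℝ 2 f p) (v : X) :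
    HasFDerivAt (fun x => fderiv ℝ f x v) ((fderiv ℝ (fderiv ℝ f) p).flip v) p := by
  simpa using (hasFDerivAt_fderiv hf).clm_apply (hasFDerivAt_const v p)

theorem fderiv_fderiv_comm {f : X → Y} {p : X} (hf : ContDiffAt ℝ 2 f p) (v w : X) :
    fderiv ℝ (fderiv ℝ f) p v w = fderiv ℝ (fderiv ℝ f) p w v :=
  hf.isSymmSndFDerivAt (by simp) v w

theorem deriv_deriv_nonneg_of_isLocalMin {a : ℝ → ℝ} {t : ℝ} (ha : ContinuousAt a t)
    (hmin : IsLocalMin a t) : 0 ≤ deriv (deriv a) t := by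
  by_contra! hneg
  have hmax := isLocalMax_of_deriv_deriv_neg hneg hmin.deriv_eq_zero ha
  have hconst : a =ᶠ[𝓝 t] fun _ => a t := by
    filter_upwards [hmin, hmax] with s hs hs' using le_antisymm hs' hs
  have hzero : deriv a =ᶠ[𝓝 t] fun _ => 0 := by simpa using hconst.deriv
  simp [hzero.deriv_eq] at hneg

theorem fderiv_fderiv_nonneg_of_isLocalMinOn {a : X → ℝ} {s : Set X} {p v : X}
    (ha : ContDiffAt ℝ 2 a p) (hmin : IsLocalMinOn a s p)
    (hv : ∀ᶠ t : ℝ in 𝓝 0, p + t • v ∈ s) : 0 ≤ fderiv ℝ (fderiv ℝ a) p v v := by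
  have hline (t : ℝ) : HasDerivAt (fun t : ℝ => p + t • v) v t := by
    simpa using ((hasDerivAt_id t).smul_const v).const_add p
  have hp : Tendsto (fun t : ℝ => p + t • v) (𝓝 0) (𝓝 p) := by
    simpa using (hline 0).continuousAt.tendsto
  have hderiv : deriv (fun t : ℝ => a (p + t • v)) =ᶠ[𝓝 0]
      fun t => fderiv ℝ a (p + t • v) v := by
    filter_upwards [hp.eventually (eventually_differentiableAt ha)] with t ht
    exact (ht.hasFDerivAt.comp_hasDerivAt t (hline t)).deriv
  have hderiv2 : deriv (deriv fun t : ℝ => a (p + t • v)) 0 = fderiv ℝ (fderiv ℝ a) p v v := by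
    rw [hderiv.deriv_eq]
    exact (HasFDerivAt.comp_hasDerivAt_of_eq 0 (hasFDerivAt_fderiv_apply ha v) (hline 0)
      (by simp)).deriv
  rw [← hderiv2]
  refine deriv_deriv_nonneg_of_isLocalMin ?_ ?_
  · exact ContinuousAt.comp_of_eq ha.continuousAt (hline 0).continuousAt (by simp)
  · filter_upwards [(tendsto_nhdsWithin_iff.2 ⟨hp, hv⟩).eventually hmin] with t ht
    simpa using ht

theorem fderiv_inl_eq_zero_of_isLocalMinOn {a : X × ℝ → ℝ} {p : X × ℝ}
    (ha : DifferentiableAt ℝ a p) (hmin : IsLocalMinOn a {x | x.2 ≤ p.2} p) (v : X) :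
    fderiv ℝ a p (v, 0) = 0 := by
  have htangent (w : X) : (w, (0 : ℝ)) ∈ posTangentConeAt {x : X × ℝ | x.2 ≤ p.2} p := by
    refine mem_posTangentConeAt_of_segment_subset (Convex.segment_subset ?_ ?_ ?_)
    · exact convex_halfSpace_le (LinearMap.snd ℝ X ℝ).isLinear p.2
    all_goals simp
  exact hmin.hasFDerivWithinAt_eq_zero ha.hasFDerivAt.hasFDerivWithinAt (htangent v)
    (by simpa using htangent (-v))

theorem fderiv_inr_nonpos_of_isLocalMinOn {a : X × ℝ → ℝ} {p : X × ℝ}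
    (ha : DifferentiableAt ℝ a p) (hmin : IsLocalMinOn a {x | x.2 ≤ p.2} p) :
    fderiv ℝ a p (0, 1) ≤ 0 := by
  have htangent : ((0 : X), (-1 : ℝ)) ∈ posTangentConeAt {x : X × ℝ | x.2 ≤ p.2} p := by
    refine mem_posTangentConeAt_of_segment_subset (Convex.segment_subset ?_ ?_ ?_)
    · exact convex_halfSpace_le (LinearMap.snd ℝ X ℝ).isLinear p.2
    all_goals simp
  have hneg := hmin.hasFDerivWithinAt_nonneg ha.hasFDerivAt.hasFDerivWithinAt htangent
  rw [show ((0 : X), (-1 : ℝ)) = -(0, 1) by simp, map_neg] at hneg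
  exact neg_nonneg.1 hneg

theorem hasDerivAt_prodMk_right {f : X × ℝ → Y} {f' : X × ℝ →L[ℝ] Y} {p : X × ℝ}
    (hf : HasFDerivAt f f' p) : HasDerivAt (fun s => f (p.1, s)) (f' (0, 1)) p.2 :=
  HasFDerivAt.comp_hasDerivAt p.2 (f := fun s => (p.1, s)) hf
    ((hasDerivAt_const p.2 p.1).prodMk (hasDerivAt_id p.2))

theorem hasFDerivAt_slice {U : Set X} {I : Set ℝ} {f : X × ℝ → Y} {p : X × ℝ}
    (hU : IsOpen U) (hf : DifferentiableOn ℝ f (U ×ˢ I)) (hp : p ∈ U ×ˢ I) :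
    HasFDerivAt (fun x => f (x, p.2))
      ((fderivWithin ℝ f (U ×ˢ I) p).comp (ContinuousLinearMap.inl ℝ X ℝ)) p.1 := by
  have hslice : HasFDerivWithinAt (fun x => (x, p.2)) (ContinuousLinearMap.inl ℝ X ℝ) U p.1 :=
    (hasFDerivAt_prodMk_left p.1 p.2).hasFDerivWithinAt
  have hmaps : MapsTo (fun x => (x, p.2)) U (U ×ˢ I) := fun x hx => ⟨hx, hp.2⟩
  exact (HasFDerivWithinAt.comp p.1 (hf p hp).hasFDerivWithinAt hslice hmaps).hasFDerivAt
    (hU.mem_nhds hp.1)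

theorem contDiffOn_fderiv_slice {k m : WithTop ℕ∞} {U : Set X} {I : Set ℝ}
    {f : X × ℝ → Y} (hU : IsOpen U) (hI : UniqueDiffOn ℝ I) (hf : ContDiffOn ℝ k f (U ×ˢ I))
    (hm : m + 1 ≤ k) :
    ContDiffOn ℝ m (fun p : X × ℝ => fderiv ℝ (fun x => f (x, p.2)) p.1) (U ×ˢ I) := by
  have hk : k ≠ 0 := by
    rintro rfl
    simp at hm
  refine ((hf.fderivWithin (hU.uniqueDiffOn.prod hI) hm).clm_comp
    (contDiffOn_const (c := ContinuousLinearMap.inl ℝ X ℝ))).congr fun p hp => ?_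
  exact (hasFDerivAt_slice hU (hf.differentiableOn hk) hp).fderiv

/-- The partial derivative of `f` in its first variable. It only looks at the slice through `p`, so
it is meaningful also where `f` is not differentiable in the second variable. -/
noncomputable def fderivFst (f : X × ℝ → Y) (p : X × ℝ) : X →ₗ[ℝ] Y :=
  (fderiv ℝ (fun x => f (x, p.2)) p.1).toLinearMap

theorem fderivFst_apply {f : X × ℝ → Y} {p : X × ℝ} (hf : DifferentiableAt ℝ f p) (v : X) :
    fderivFst f p v = fderiv ℝ f p (v, 0) := by
  have hslice := HasFDerivAt.comp p.1 (f := fun x => (x, p.2)) hf.hasFDerivAt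
    (hasFDerivAt_prodMk_left p.1 p.2)
  exact congrArg (fun L => L v) hslice.fderiv

theorem hasDerivAt_fderivFst {f : X × ℝ → Y} {p : X × ℝ} (hf : ContDiffAt ℝ 2 f p) (v : X) :
    HasDerivAt (fun s => fderivFst f (p.1, s) v) (fderiv ℝ (fderiv ℝ f) p (0, 1) (v, 0)) p.2 := by
  refine (hasDerivAt_prodMk_right (hasFDerivAt_fderiv_apply hf (v, 0))).congr_of_eventuallyEq ?_
  filter_upwards [(Continuous.prodMk_right p.1).continuousAt.eventually
    (eventually_differentiableAt hf)] with s hs using fderivFst_apply hs v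

/-- The Hessian of `a` in its first variable. -/
noncomputable def hessianFst (a : X × ℝ → ℝ) (p : X × ℝ) : LinearMap.BilinForm ℝ X :=
  (fderiv ℝ (fderiv ℝ a) p).toBilinForm.comp (LinearMap.inl ℝ X ℝ) (LinearMap.inl ℝ X ℝ)

theorem hessianFst_apply (a : X × ℝ → ℝ) (p : X × ℝ) (v w : X) :
    hessianFst a p v w = fderiv ℝ (fderiv ℝ a) p (v, 0) (w, 0) := rfl

theorem posSemidef_toMatrix_hessianFst_of_isLocalMinOn {ι : Type*} [Fintype ι] [DecidableEq ι]
    (b : Module.Basis ι ℝ X) {a : X × ℝ → ℝ} {p : X × ℝ} (ha : ContDiffAt ℝ 2 a p)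
    (hmin : IsLocalMinOn a {x | x.2 ≤ p.2} p) : ((hessianFst a p).toMatrix b).PosSemidef :=
  posSemidef_toMatrix b ⟨fun v w => fderiv_fderiv_comm ha (v, 0) (w, 0)⟩ fun _ =>
    fderiv_fderiv_nonneg_of_isLocalMinOn ha hmin (by simp)

variable {E : Type*} [NormedAddCommGroup E] [InnerProductSpace ℝ E]

theorem inner_fderiv_self_eq_zero {ν : X → E} {p : X} (hν : DifferentiableAt ℝ ν p) {c : ℝ}
    (hnorm : ∀ᶠ x in 𝓝 p, ‖ν x‖ = c) (w : X) : ⟪fderiv ℝ ν p w, ν p⟫ = 0 := by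
  have hconst : (fun x => ⟪ν x, ν x⟫) =ᶠ[𝓝 p] fun _ => c ^ 2 := by
    filter_upwards [hnorm] with x hx
    rw [real_inner_self_eq_norm_sq, hx]
  have hprod := fderiv_inner_apply ℝ hν hν w
  rw [hconst.fderiv_eq, real_inner_comm] at hprod
  simp only [fderiv_fun_const, Pi.zero_apply, _root_.zero_apply] at hprod
  linarith

theorem inner_fderiv_fderiv_eq_neg {f ν : X → E} {p v : X} (hf : ContDiffAt ℝ 2 f p)
    (hν : DifferentiableAt ℝ ν p) (hperp : ∀ᶠ x in 𝓝 p, ⟪fderiv ℝ f x v, ν x⟫ = 0) (w : X) :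
    ⟪fderiv ℝ f p v, fderiv ℝ ν p w⟫ = -⟪fderiv ℝ (fderiv ℝ f) p w v, ν p⟫ := by
  have hfv := hasFDerivAt_fderiv_apply hf v
  have hprod := fderiv_inner_apply ℝ hfv.differentiableAt hν w
  rw [(show (fun x => ⟪fderiv ℝ f x v, ν x⟫) =ᶠ[𝓝 p] fun _ => 0 from hperp).fderiv_eq,
    hfv.fderiv] at hprod
  simp only [fderiv_fun_const, Pi.zero_apply, _root_.zero_apply,
    ContinuousLinearMap.flip_apply] at hprod
  linarith

theorem inner_fderiv_fderiv_comm {f ν : X → E} {p v w : X} (hf : ContDiffAt ℝ 2 f p)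
    (hν : DifferentiableAt ℝ ν p) (hv : ∀ᶠ x in 𝓝 p, ⟪fderiv ℝ f x v, ν x⟫ = 0)
    (hw : ∀ᶠ x in 𝓝 p, ⟪fderiv ℝ f x w, ν x⟫ = 0) :
    ⟪fderiv ℝ f p v, fderiv ℝ ν p w⟫ = ⟪fderiv ℝ f p w, fderiv ℝ ν p v⟫ := by
  rw [inner_fderiv_fderiv_eq_neg hf hν hv, inner_fderiv_fderiv_eq_neg hf hν hw,
    fderiv_fderiv_comm hf]

theorem fderiv_sub_inner_apply {a : X → ℝ} {f : X → E} {p : X} (ha : DifferentiableAt ℝ a p)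
    (hf : DifferentiableAt ℝ f p) (e : E) (v : X) :
    fderiv ℝ (fun x => a x - ⟪e, f x⟫) p v = fderiv ℝ a p v - ⟪e, fderiv ℝ f p v⟫ := by
  rw [fderiv_fun_sub ha ((differentiableAt_const e).inner ℝ hf), _root_.sub_apply,
    fderiv_inner_apply ℝ (differentiableAt_const e) hf]
  simp

theorem fderiv_fderiv_sub_inner_apply {a : X → ℝ} {f : X → E} {p : X} (ha : ContDiffAt ℝ 2 a p)
    (hf : ContDiffAt ℝ 2 f p) (e : E) (v w : X) :
    fderiv ℝ (fderiv ℝ fun x => a x - ⟪e, f x⟫) p w v =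
      fderiv ℝ (fderiv ℝ a) p w v - ⟪e, fderiv ℝ (fderiv ℝ f) p w v⟫ := by
  have hsub : ContDiffAt ℝ 2 (fun x => a x - ⟪e, f x⟫) p := ha.sub (contDiffAt_const.inner ℝ hf)
  have heq : (fun x => fderiv ℝ (fun x => a x - ⟪e, f x⟫) x v) =ᶠ[𝓝 p]
      fun x => fderiv ℝ a x v - ⟪e, fderiv ℝ f x v⟫ := by
    filter_upwards [eventually_differentiableAt ha, eventually_differentiableAt hf] with x hax hfx
    exact fderiv_sub_inner_apply hax hfx e v
  have hav := hasFDerivAt_fderiv_apply ha v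
  have hfv := hasFDerivAt_fderiv_apply hf v
  rw [← ContinuousLinearMap.flip_apply, ← (hasFDerivAt_fderiv_apply hsub v).fderiv, heq.fderiv_eq,
    fderiv_sub_inner_apply hav.differentiableAt hfv.differentiableAt, hav.fderiv, hfv.fderiv]
  rfl

end Calculus

section Threshold

/-- The constant `(n (n + 2) / (n - 1)) ^ (n - 1) / γ ^ (2 n + 1)`, at most `threshold n γ`, above
which the maximum principle for `chi` applies. -/
noncomputable def sharpThreshold (n : ℕ) (γ : ℝ) : ℝ :=
  (n * (n + 2) / ((n : ℝ) - 1)) ^ (n - 1) / γ ^ (2 * n + 1)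

theorem sharpThreshold_le_threshold {n : ℕ} {γ : ℝ} (hn : 2 ≤ n) (hγ0 : 0 < γ) (hγ1 : γ ≤ 1) :
    sharpThreshold n γ ≤ threshold n γ := by
  have hn2 : (2 : ℝ) ≤ n := by exact_mod_cast hn
  have hcast : ((n - 1 : ℕ) : ℝ) = n - 1 := by rw [Nat.cast_sub (by lia), Nat.cast_one]
  have hpow : (γ ^ ((4 * (n : ℝ) + 8) / ((n : ℝ) - 1) + 2 * n + 4)) ^ (n - 1) ≤
      γ ^ (2 * n + 1) := by
    rw [← Real.rpow_mul_natCast hγ0.le, ← Real.rpow_natCast γ (2 * n + 1), hcast]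
    refine Real.rpow_le_rpow_of_exponent_ge hγ0 hγ1 ?_
    rw [add_assoc, add_mul, div_mul_cancel₀ _ (by linarith)]
    push_cast
    nlinarith
  rw [threshold, sharpThreshold, ← div_div, div_pow _ (γ ^ _)]
  have hpos : 0 < (n : ℝ) - 1 := by linarith
  gcongr
  nlinarith

theorem pow_lt_of_card_pow_mul_le {m : ℕ} {γ lam r u k K : ℝ} (hm : 0 < m) (hγ : 0 < γ)
    (hr : 0 < r) (hangle : γ * r ≤ u) (hlam : 0 ≤ lam) (hmean : (m : ℝ) ^ m * K ≤ k ^ m) {c : ℝ}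
    (hk : 0 ≤ k) (hcurv : k * u < c) (heq : lam * u ^ (m + 3) = r ^ (2 * m + 3) * K) :
    (m : ℝ) ^ m * lam * γ ^ (2 * m + 3) < c ^ m := by
  have hu : 0 < u := (mul_pos hγ hr).trans_le hangle
  refine lt_of_mul_lt_mul_right ?_ (pow_pos hr (2 * m + 3)).le
  calc (m : ℝ) ^ m * lam * γ ^ (2 * m + 3) * r ^ (2 * m + 3)
      = (m : ℝ) ^ m * lam * (γ * r) ^ (2 * m + 3) := by ring
    _ ≤ (m : ℝ) ^ m * lam * u ^ (2 * m + 3) := by gcongr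
    _ = (m : ℝ) ^ m * (lam * u ^ (m + 3)) * u ^ m := by ring
    _ = (m : ℝ) ^ m * K * u ^ m * r ^ (2 * m + 3) := by rw [heq]; ring
    _ ≤ k ^ m * u ^ m * r ^ (2 * m + 3) := by gcongr
    _ < c ^ m * r ^ (2 * m + 3) := by rw [← mul_pow]; gcongr

theorem lt_sharpThreshold {m : ℕ} {γ lam r u k K : ℝ} (hm : 0 < m) (hγ : 0 < γ)
    (hr : 0 < r) (hangle : γ * r ≤ u) (hlam : 0 ≤ lam) (hk : 0 ≤ k)
    (hmean : (m : ℝ) ^ m * K ≤ k ^ m) (hcurv : k * u < (m + 1) * (m + 3))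
    (heq : lam * u ^ (m + 3) = r ^ (2 * m + 3) * K) : lam < sharpThreshold (m + 1) γ := by
  have hpow := pow_lt_of_card_pow_mul_le hm hγ hr hangle hlam hmean hk hcurv heq
  rw [sharpThreshold, Nat.add_sub_cancel, div_pow, lt_div_iff₀ (by positivity)]
  push_cast
  rw [add_sub_cancel_right, lt_div_iff₀ (by positivity), add_assoc (m : ℝ) 1 2]
  norm_num1
  exact Eq.trans_lt (by ring) hpow

end Threshold

section Barrier

variable {X E : Type*} [TopologicalSpace X] [NormedAddCommGroup E] [InnerProductSpace ℝ E]

theorem norm_pow_mul_le_norm_pow {z : E} (hz : z ≠ 0) (y : E) (m : ℕ) :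
    ‖z‖ ^ m * (1 + m * (⟪z, y⟫ / ‖z‖ ^ 2 - 1)) ≤ ‖y‖ ^ m := by
  have hr : 0 < ‖z‖ := norm_pos_iff.2 hz
  have hinner : ⟪z, y⟫ / ‖z‖ ^ 2 ≤ ‖y‖ / ‖z‖ := by
    rw [div_le_div_iff₀ (by positivity) hr]
    nlinarith [real_inner_le_norm z y]
  have hratio : 0 ≤ ‖y‖ / ‖z‖ := by positivity
  calc ‖z‖ ^ m * (1 + m * (⟪z, y⟫ / ‖z‖ ^ 2 - 1))
      ≤ ‖z‖ ^ m * (1 + m * (‖y‖ / ‖z‖ - 1)) := by gcongr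
    _ ≤ ‖z‖ ^ m * (‖y‖ / ‖z‖) ^ m := by
        gcongr
        exact one_add_mul_sub_le_pow (by linarith) m
    _ = ‖y‖ ^ m := by rw [← mul_pow, mul_div_cancel₀ _ hr.ne']

theorem isLocalMinOn_sub_inner_of_norm_pow_le {f : X → E} {S : X → ℝ} {s : Set X} {p : X}
    (hf0 : f p ≠ 0) {lam : ℝ} (hlam : 0 < lam) {m : ℕ} (heq : ‖f p‖ ^ m = lam * S p)
    (hle : ∀ᶠ x in 𝓝[s] p, ‖f x‖ ^ m ≤ lam * S x) :
    IsLocalMinOn (fun x => S x - ⟪(m * S p / ‖f p‖ ^ 2) • f p, f x⟫) s p := by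
  have hr : ‖f p‖ ≠ 0 := norm_ne_zero_iff.2 hf0
  filter_upwards [hle] with x hx
  have hconvex := (norm_pow_mul_le_norm_pow hf0 (f x) m).trans hx
  rw [heq, mul_assoc] at hconvex
  have hlower := le_of_mul_le_mul_left hconvex hlam
  have hp : m * S p / ‖f p‖ ^ 2 * ‖f p‖ ^ 2 = m * S p := by field
  simp only [real_inner_smul_left, real_inner_self_eq_norm_sq]
  linear_combination hlower - hp

end Barrier

section NormalFlow

variable {F E : Type*} [NormedAddCommGroup F] [NormedSpace ℝ F]
  [NormedAddCommGroup E] [InnerProductSpace ℝ E]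

/-- A family of hypersurfaces, parametrized by the slices of the open set `W`, with unit normal `ν`
and moving with normal speed `S`. -/
structure IsNormalFlow (W : Set (F × ℝ)) (f ν : F × ℝ → E) (S : F × ℝ → ℝ) : Prop where
  isOpen : IsOpen W
  contDiffAt_map : ∀ p ∈ W, ContDiffAt ℝ 2 f p
  contDiffAt_normal : ∀ p ∈ W, ContDiffAt ℝ 2 ν p
  contDiffAt_speed : ∀ p ∈ W, ContDiffAt ℝ 2 S p
  norm_normal : ∀ p ∈ W, ‖ν p‖ = 1
  inner_normal : ∀ p ∈ W, ∀ v, ⟪fderiv ℝ f p (v, 0), ν p⟫ = 0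
  flow : ∀ p ∈ W, fderiv ℝ f p (0, 1) = S p • ν p

namespace IsNormalFlow

variable {W : Set (F × ℝ)} {f ν : F × ℝ → E} {S : F × ℝ → ℝ} {p : F × ℝ}

theorem differentiableAt_map (H : IsNormalFlow W f ν S) (hp : p ∈ W) : DifferentiableAt ℝ f p :=
  (H.contDiffAt_map p hp).differentiableAt (by simp)

theorem differentiableAt_normal (H : IsNormalFlow W f ν S) (hp : p ∈ W) :
    DifferentiableAt ℝ ν p :=
  (H.contDiffAt_normal p hp).differentiableAt (by simp)

theorem differentiableAt_speed (H : IsNormalFlow W f ν S) (hp : p ∈ W) :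
    DifferentiableAt ℝ S p :=
  (H.contDiffAt_speed p hp).differentiableAt (by simp)

theorem eventually_inner_normal (H : IsNormalFlow W f ν S) (hp : p ∈ W) (v : F) :
    ∀ᶠ x in 𝓝 p, ⟪fderiv ℝ f x (v, 0), ν x⟫ = 0 :=
  (H.isOpen.eventually_mem hp).mono fun x hx => H.inner_normal x hx v

theorem inner_fderiv_normal (H : IsNormalFlow W f ν S) (hp : p ∈ W) (w : F × ℝ) :
    ⟪fderiv ℝ ν p w, ν p⟫ = 0 :=
  inner_fderiv_self_eq_zero (H.differentiableAt_normal hp)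
    ((H.isOpen.eventually_mem hp).mono H.norm_normal) w

theorem isSymm_pairing (H : IsNormalFlow W f ν S) (hp : p ∈ W) :
    (pairing (fderivFst f p) (fderivFst ν p)).IsSymm := by
  refine ⟨fun v w => ?_⟩
  simp only [pairing_apply, fderivFst_apply (H.differentiableAt_map hp),
    fderivFst_apply (H.differentiableAt_normal hp)]
  exact inner_fderiv_fderiv_comm (H.contDiffAt_map p hp) (H.differentiableAt_normal hp)
    (H.eventually_inner_normal hp v) (H.eventually_inner_normal hp w)

theorem fderiv_fderiv_map_time (H : IsNormalFlow W f ν S) (hp : p ∈ W) (v : F) :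
    fderiv ℝ (fderiv ℝ f) p (0, 1) (v, 0) =
      S p • fderiv ℝ ν p (v, 0) + fderiv ℝ S p (v, 0) • ν p := by
  have hf := H.contDiffAt_map p hp
  have hflow : (fun x => fderiv ℝ f x (0, 1)) =ᶠ[𝓝 p] fun x => S x • ν x :=
    (H.isOpen.eventually_mem hp).mono H.flow
  rw [fderiv_fderiv_comm hf, ← ContinuousLinearMap.flip_apply,
    ← (hasFDerivAt_fderiv_apply hf (0, 1)).fderiv, hflow.fderiv_eq,
    fderiv_fun_smul (H.differentiableAt_speed hp) (H.differentiableAt_normal hp)]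
  simp

theorem inner_fderiv_map_fderiv_normal_time (H : IsNormalFlow W f ν S) (hp : p ∈ W) (v : F) :
    ⟪fderiv ℝ f p (v, 0), fderiv ℝ ν p (0, 1)⟫ = -fderiv ℝ S p (v, 0) := by
  rw [inner_fderiv_fderiv_eq_neg (H.contDiffAt_map p hp) (H.differentiableAt_normal hp)
    (H.eventually_inner_normal hp v), H.fderiv_fderiv_map_time hp, inner_add_left,
    real_inner_smul_left, real_inner_smul_left, H.inner_fderiv_normal hp,
    real_inner_self_eq_norm_sq, H.norm_normal p hp]
  ring

theorem hasDerivAt_first_form (H : IsNormalFlow W f ν S) (hp : p ∈ W) (v w : F) :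
    HasDerivAt (fun s => pairing (fderivFst f (p.1, s)) (fderivFst f (p.1, s)) v w)
      (2 * S p * pairing (fderivFst f p) (fderivFst ν p) v w) p.2 := by
  have hf := H.contDiffAt_map p hp
  refine ((hasDerivAt_fderivFst hf v).inner ℝ (hasDerivAt_fderivFst hf w)).congr_deriv ?_
  have hsymm := (H.isSymm_pairing hp).eq w v
  simp only [pairing_apply, Prod.mk.eta,
    fderivFst_apply (H.differentiableAt_map hp),
    fderivFst_apply (H.differentiableAt_normal hp)] at hsymm ⊢
  simp only [H.fderiv_fderiv_map_time hp, inner_add_left, inner_add_right, real_inner_smul_left,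
    real_inner_smul_right, H.inner_normal p hp, real_inner_comm _ (ν p),
    real_inner_comm (fderiv ℝ f p (w, 0)) (fderiv ℝ ν p (v, 0)), hsymm]
  ring

theorem inner_fderiv_fderiv_normal_time (H : IsNormalFlow W f ν S) (hp : p ∈ W) (v w : F) :
    ⟪fderiv ℝ f p (v, 0), fderiv ℝ (fderiv ℝ ν) p (0, 1) (w, 0)⟫ =
      -fderiv ℝ (fderiv ℝ S) p (w, 0) (v, 0) -
        ⟪fderiv ℝ (fderiv ℝ f) p (w, 0) (v, 0), fderiv ℝ ν p (0, 1)⟫ := by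
  have hfv := hasFDerivAt_fderiv_apply (H.contDiffAt_map p hp) (v, 0)
  have hνt := hasFDerivAt_fderiv_apply (H.contDiffAt_normal p hp) (0, 1)
  have hSv := hasFDerivAt_fderiv_apply (H.contDiffAt_speed p hp) (v, 0)
  have heq : (fun x => ⟪fderiv ℝ f x (v, 0), fderiv ℝ ν x (0, 1)⟫) =ᶠ[𝓝 p]
      fun x => -fderiv ℝ S x (v, 0) := by
    filter_upwards [H.isOpen.eventually_mem hp] with x hx
    exact H.inner_fderiv_map_fderiv_normal_time hx v
  have hprod := fderiv_inner_apply ℝ hfv.differentiableAt hνt.differentiableAt (w, 0)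
  rw [heq.fderiv_eq, hSv.fun_neg.fderiv, hfv.fderiv, hνt.fderiv] at hprod
  simp only [_root_.neg_apply, ContinuousLinearMap.flip_apply] at hprod
  rw [fderiv_fderiv_comm (H.contDiffAt_normal p hp)]
  linarith

theorem hasDerivAt_second_form (H : IsNormalFlow W f ν S) (hp : p ∈ W) (v w : F) :
    HasDerivAt (fun s => pairing (fderivFst f (p.1, s)) (fderivFst ν (p.1, s)) v w)
      (S p * pairing (fderivFst ν p) (fderivFst ν p) v w -
        fderiv ℝ (fderiv ℝ S) p (w, 0) (v, 0) -
        ⟪fderiv ℝ (fderiv ℝ f) p (w, 0) (v, 0), fderiv ℝ ν p (0, 1)⟫) p.2 := by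
  refine ((hasDerivAt_fderivFst (H.contDiffAt_map p hp) v).inner ℝ
    (hasDerivAt_fderivFst (H.contDiffAt_normal p hp) w)).congr_deriv ?_
  simp only [pairing_apply, Prod.mk.eta,
    fderivFst_apply (H.differentiableAt_map hp), fderivFst_apply (H.differentiableAt_normal hp),
    H.inner_fderiv_fderiv_normal_time hp, H.fderiv_fderiv_map_time hp, inner_add_left,
    real_inner_smul_left, real_inner_comm _ (ν p), H.inner_fderiv_normal hp]
  ring

variable {e : E}

theorem fderiv_speed_apply_inl (H : IsNormalFlow W f ν S) (hp : p ∈ W)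
    (hmin : IsLocalMinOn (fun x => S x - ⟪e, f x⟫) {x | x.2 ≤ p.2} p) (v : F) :
    fderiv ℝ S p (v, 0) = ⟪e, fderiv ℝ f p (v, 0)⟫ := by
  have hS := H.differentiableAt_speed hp
  have hf := H.differentiableAt_map hp
  have hzero := fderiv_inl_eq_zero_of_isLocalMinOn
    (hS.fun_sub ((differentiableAt_const e).inner ℝ hf)) hmin v
  rwa [fderiv_sub_inner_apply hS hf, sub_eq_zero] at hzero

theorem fderiv_speed_apply_inr_le (H : IsNormalFlow W f ν S) (hp : p ∈ W)
    (hmin : IsLocalMinOn (fun x => S x - ⟪e, f x⟫) {x | x.2 ≤ p.2} p) :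
    fderiv ℝ S p (0, 1) ≤ S p * ⟪e, ν p⟫ := by
  have hS := H.differentiableAt_speed hp
  have hf := H.differentiableAt_map hp
  have hnonpos := fderiv_inr_nonpos_of_isLocalMinOn
    (hS.fun_sub ((differentiableAt_const e).inner ℝ hf)) hmin
  rwa [fderiv_sub_inner_apply hS hf, H.flow p hp, real_inner_smul_right, sub_nonpos] at hnonpos

theorem logDeriv_norm (H : IsNormalFlow W f ν S) (hp : p ∈ W) (hf0 : f p ≠ 0) :
    logDeriv (fun s => ‖f (p.1, s)‖) p.2 = S p * ⟪f p, ν p⟫ / ‖f p‖ ^ 2 := by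
  have hderiv := (hasDerivAt_prodMk_right (H.differentiableAt_map hp).hasFDerivAt).norm_sq
  have hsqrt := hderiv.sqrt (pow_ne_zero 2 (norm_ne_zero_iff.2 hf0))
  simp only [Real.sqrt_sq (norm_nonneg _), H.flow p hp, real_inner_smul_right] at hsqrt
  rw [logDeriv_apply, hsqrt.deriv]
  field

theorem logDeriv_speed_le (H : IsNormalFlow W f ν S) (hp : p ∈ W) (hS : 0 < S p)
    (hmin : IsLocalMinOn (fun x => S x - ⟪e, f x⟫) {x | x.2 ≤ p.2} p) :
    logDeriv (fun s => S (p.1, s)) p.2 ≤ ⟪e, ν p⟫ := by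
  rw [logDeriv_apply, (hasDerivAt_prodMk_right (H.differentiableAt_speed hp).hasFDerivAt).deriv,
    div_le_iff₀ hS, mul_comm]
  exact H.fderiv_speed_apply_inr_le hp hmin

variable {ι : Type*} [Fintype ι] [DecidableEq ι]

theorem hasDerivAt_toMatrix_first_form (H : IsNormalFlow W f ν S) (hp : p ∈ W)
    (b : Module.Basis ι ℝ F) (i j : ι) :
    HasDerivAt (fun s => (pairing (fderivFst f (p.1, s)) (fderivFst f (p.1, s))).toMatrix b i j)
      (((2 * S p) • (pairing (fderivFst f p) (fderivFst ν p)).toMatrix b) i j) p.2 := by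
  simp only [Matrix.smul_apply, LinearMap.BilinForm.toMatrix_apply, smul_eq_mul]
  exact H.hasDerivAt_first_form hp (b i) (b j)

theorem differentiableAt_gaussKronecker (H : IsNormalFlow W f ν S) (hp : p ∈ W)
    (b : Module.Basis ι ℝ F) (hinj : Function.Injective (fderivFst f p)) :
    DifferentiableAt ℝ
      (fun s => gaussKronecker b (fderivFst f (p.1, s)) (fderivFst ν (p.1, s))) p.2 := by
  have hdet : HasDerivAt
      (fun s => ((pairing (fderivFst f (p.1, s)) (fderivFst ν (p.1, s))).toMatrix b).det) _ p.2 :=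
    hasDerivAt_det (A' := Matrix.of fun i j => _) fun i j => by
      simp only [LinearMap.BilinForm.toMatrix_apply]
      exact H.hasDerivAt_second_form hp (b i) (b j)
  exact hdet.differentiableAt.div
    (hasDerivAt_det fun i j => H.hasDerivAt_toMatrix_first_form hp b i j).differentiableAt
    (posDef_toMatrix_pairing_self b hinj).det_pos.ne'

theorem logDeriv_speed_add_logDeriv_gaussKronecker (H : IsNormalFlow W f ν S) (hp : p ∈ W)
    (b : Module.Basis ι ℝ F) (hinj : Function.Injective (fderivFst f p)) (hS : S p ≠ 0)
    (hf0 : f p ≠ 0) (hK : gaussKronecker b (fderivFst f p) (fderivFst ν p) ≠ 0) {n m : ℕ}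
    (hlaw : ∀ x ∈ W, S x * (‖f x‖ ^ n * gaussKronecker b (fderivFst f x) (fderivFst ν x)) =
      ⟪f x, ν x⟫ ^ m) :
    logDeriv (fun s => S (p.1, s)) p.2 + (n * logDeriv (fun s => ‖f (p.1, s)‖) p.2 +
      logDeriv (fun s => gaussKronecker b (fderivFst f (p.1, s)) (fderivFst ν (p.1, s))) p.2) =
      m * logDeriv (fun s => ⟪f (p.1, s), ν (p.1, s)⟫) p.2 := by
  have hft := (hasDerivAt_prodMk_right (H.differentiableAt_map hp).hasFDerivAt).differentiableAt
  have hνt := (hasDerivAt_prodMk_right (H.differentiableAt_normal hp).hasFDerivAt).differentiableAt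
  have hSt := (hasDerivAt_prodMk_right (H.differentiableAt_speed hp).hasFDerivAt).differentiableAt
  have hKt := H.differentiableAt_gaussKronecker hp b hinj
  have hrt := hft.norm ℝ hf0
  have hr : ‖f p‖ ^ n ≠ 0 := pow_ne_zero n (norm_ne_zero_iff.2 hf0)
  have hrK := mul_ne_zero hr hK
  have hlaw' : (fun s => S (p.1, s) * (‖f (p.1, s)‖ ^ n *
      gaussKronecker b (fderivFst f (p.1, s)) (fderivFst ν (p.1, s)))) =ᶠ[𝓝 p.2]
      fun s => ⟪f (p.1, s), ν (p.1, s)⟫ ^ m :=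
    ((Continuous.prodMk_right p.1).continuousAt.eventually (H.isOpen.eventually_mem hp)).mono
      fun s hs => hlaw (p.1, s) hs
  rw [← logDeriv_fun_pow (hft.inner ℝ hνt), ← logDeriv_fun_pow hrt,
    ← logDeriv_mul p.2 hr hK (hrt.fun_pow n) hKt,
    ← logDeriv_mul p.2 hS hrK hSt ((hrt.fun_pow n).fun_mul hKt)]
  simp only [logDeriv_apply, Prod.mk.eta]
  rw [hlaw'.deriv_eq, hlaw p hp]

variable [FiniteDimensional ℝ E]

theorem range_fderivFst (H : IsNormalFlow W f ν S) (hp : p ∈ W)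
    (hdim : Module.finrank ℝ E = Module.finrank ℝ F + 1)
    (hinj : Function.Injective (fderivFst f p)) :
    LinearMap.range (fderivFst f p) = (ℝ ∙ ν p)ᗮ := by
  refine range_eq_orthogonal_span_singleton hinj hdim ?_ fun v => ?_
  · exact norm_ne_zero_iff.1 ((H.norm_normal p hp).trans_ne one_ne_zero)
  · rw [fderivFst_apply (H.differentiableAt_map hp), H.inner_normal p hp]

theorem fderiv_normal_time (H : IsNormalFlow W f ν S) (hp : p ∈ W)
    (hdim : Module.finrank ℝ E = Module.finrank ℝ F + 1)
    (hinj : Function.Injective (fderivFst f p))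
    (hmin : IsLocalMinOn (fun x => S x - ⟪e, f x⟫) {x | x.2 ≤ p.2} p) :
    fderiv ℝ ν p (0, 1) = ⟪e, ν p⟫ • ν p - e := by
  have hν : ⟪ν p, ν p⟫ = 1 := by rw [real_inner_self_eq_norm_sq, H.norm_normal p hp, one_pow]
  set y := fderiv ℝ ν p (0, 1) - (⟪e, ν p⟫ • ν p - e) with hy
  have htangent : y ∈ LinearMap.range (fderivFst f p) := by
    rw [H.range_fderivFst hp hdim hinj, Submodule.mem_orthogonal_singleton_iff_inner_left]
    simp only [hy, inner_sub_left, real_inner_smul_left, H.inner_fderiv_normal hp, hν]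
    ring
  obtain ⟨v, hv⟩ := htangent
  rw [fderivFst_apply (H.differentiableAt_map hp)] at hv
  have hperp : ⟪fderiv ℝ f p (v, 0), y⟫ = 0 := by
    simp only [hy, inner_sub_right, real_inner_smul_right, H.inner_normal p hp,
      H.inner_fderiv_map_fderiv_normal_time hp, H.fderiv_speed_apply_inl hp hmin,
      real_inner_comm e]
    ring
  rw [hv] at hperp
  exact sub_eq_zero.1 (inner_self_eq_zero.1 hperp)

theorem hasDerivAt_second_form_of_isLocalMinOn (H : IsNormalFlow W f ν S) (hp : p ∈ W)
    (hdim : Module.finrank ℝ E = Module.finrank ℝ F + 1)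
    (hinj : Function.Injective (fderivFst f p))
    (hmin : IsLocalMinOn (fun x => S x - ⟪e, f x⟫) {x | x.2 ≤ p.2} p) (v w : F) :
    HasDerivAt (fun s => pairing (fderivFst f (p.1, s)) (fderivFst ν (p.1, s)) v w)
      (S p * pairing (fderivFst ν p) (fderivFst ν p) v w -
        hessianFst (fun x => S x - ⟪e, f x⟫) p v w +
        ⟪e, ν p⟫ * pairing (fderivFst f p) (fderivFst ν p) v w) p.2 := by
  have hf := H.contDiffAt_map p hp
  have hS := H.contDiffAt_speed p hp
  refine (H.hasDerivAt_second_form hp v w).congr_deriv ?_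
  rw [hessianFst_apply, fderiv_fderiv_sub_inner_apply hS hf, fderiv_fderiv_comm hf (v, 0),
    fderiv_fderiv_comm hS (v, 0), H.fderiv_normal_time hp hdim hinj hmin, inner_sub_right,
    real_inner_smul_right, real_inner_comm e, pairing_apply (fderivFst f p),
    fderivFst_apply (H.differentiableAt_map hp), fderivFst_apply (H.differentiableAt_normal hp) w,
    inner_fderiv_fderiv_eq_neg hf (H.differentiableAt_normal hp) (H.eventually_inner_normal hp v)]
  ring

theorem hasDerivAt_toMatrix_second_form (H : IsNormalFlow W f ν S) (hp : p ∈ W)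
    (b : Module.Basis ι ℝ F) (hdim : Module.finrank ℝ E = Module.finrank ℝ F + 1)
    (hinj : Function.Injective (fderivFst f p))
    (hmin : IsLocalMinOn (fun x => S x - ⟪e, f x⟫) {x | x.2 ≤ p.2} p) (i j : ι) :
    HasDerivAt (fun s => (pairing (fderivFst f (p.1, s)) (fderivFst ν (p.1, s))).toMatrix b i j)
      ((S p • (pairing (fderivFst ν p) (fderivFst ν p)).toMatrix b -
        (hessianFst (fun x => S x - ⟪e, f x⟫) p).toMatrix b +
        ⟪e, ν p⟫ • (pairing (fderivFst f p) (fderivFst ν p)).toMatrix b) i j) p.2 := by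
  simp only [Matrix.add_apply, Matrix.sub_apply, Matrix.smul_apply,
    LinearMap.BilinForm.toMatrix_apply, smul_eq_mul]
  exact H.hasDerivAt_second_form_of_isLocalMinOn hp hdim hinj hmin (b i) (b j)

theorem logDeriv_gaussKronecker_le (H : IsNormalFlow W f ν S) (hp : p ∈ W)
    (b : Module.Basis ι ℝ F) (hdim : Module.finrank ℝ E = Module.finrank ℝ F + 1)
    (hinj : Function.Injective (fderivFst f p))
    (hpos : ∀ v, v ≠ 0 → 0 < ⟪fderivFst f p v, fderivFst ν p v⟫)
    (hmin : IsLocalMinOn (fun x => S x - ⟪e, f x⟫) {x | x.2 ≤ p.2} p) :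
    logDeriv (fun s => gaussKronecker b (fderivFst f (p.1, s)) (fderivFst ν (p.1, s))) p.2 ≤
      -S p * meanCurvature b (fderivFst f p) (fderivFst ν p) + Fintype.card ι * ⟪e, ν p⟫ := by
  have hsymm := H.isSymm_pairing hp
  have hg := H.hasDerivAt_toMatrix_first_form hp b
  have hh := H.hasDerivAt_toMatrix_second_form hp b hdim hinj hmin
  have hgpos := posDef_toMatrix_pairing_self b hinj
  have hhpos := posDef_toMatrix_pairing b hsymm hpos
  have hhess := posSemidef_toMatrix_hessianFst_of_isLocalMinOn b
    ((H.contDiffAt_speed p hp).sub (contDiffAt_const.inner ℝ (H.contDiffAt_map p hp))) hmin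
  have hrange : LinearMap.range (fderivFst ν p) ≤ LinearMap.range (fderivFst f p) := by
    rw [H.range_fderivFst hp hdim hinj]
    rintro _ ⟨v, rfl⟩
    rw [Submodule.mem_orthogonal_singleton_iff_inner_left,
      fderivFst_apply (H.differentiableAt_normal hp), H.inner_fderiv_normal hp]
  simp only [gaussKronecker]
  rw [logDeriv_div p.2 hhpos.det_pos.ne' hgpos.det_pos.ne' (hasDerivAt_det hh).differentiableAt
    (hasDerivAt_det hg).differentiableAt, logDeriv_det hh, logDeriv_det hg]
  exact trace_inv_mul_sub_trace_inv_mul_le hhpos hhess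
    (toMatrix_pairing_self_eq b hinj hrange hsymm) (S p) ⟪e, ν p⟫

theorem hasDerivAt_support (H : IsNormalFlow W f ν S) (hp : p ∈ W)
    (hdim : Module.finrank ℝ E = Module.finrank ℝ F + 1)
    (hinj : Function.Injective (fderivFst f p))
    (hmin : IsLocalMinOn (fun x => S x - ⟪e, f x⟫) {x | x.2 ≤ p.2} p) :
    HasDerivAt (fun s => ⟪f (p.1, s), ν (p.1, s)⟫)
      (S p + ⟪e, ν p⟫ * ⟪f p, ν p⟫ - ⟪e, f p⟫) p.2 := by
  refine ((hasDerivAt_prodMk_right (H.differentiableAt_map hp).hasFDerivAt).inner ℝ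
    (hasDerivAt_prodMk_right (H.differentiableAt_normal hp).hasFDerivAt)).congr_deriv ?_
  rw [H.flow p hp, H.fderiv_normal_time hp hdim hinj hmin, inner_sub_right, real_inner_smul_right,
    real_inner_smul_left, real_inner_self_eq_norm_sq, H.norm_normal p hp, real_inner_comm e]
  ring

theorem logDeriv_support (H : IsNormalFlow W f ν S) (hp : p ∈ W)
    (hdim : Module.finrank ℝ E = Module.finrank ℝ F + 1)
    (hinj : Function.Injective (fderivFst f p)) (hu : ⟪f p, ν p⟫ ≠ 0) {c : ℝ}
    (hmin : IsLocalMinOn (fun x => S x - ⟪(c * S p / ‖f p‖ ^ 2) • f p, f x⟫) {x | x.2 ≤ p.2} p) :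
    logDeriv (fun s => ⟪f (p.1, s), ν (p.1, s)⟫) p.2 =
      S p * (c * (⟪f p, ν p⟫ / ‖f p‖ ^ 2) - (c - 1) / ⟪f p, ν p⟫) := by
  have hr : ‖f p‖ ≠ 0 := norm_ne_zero_iff.2 fun h => hu (by rw [h, inner_zero_left])
  rw [logDeriv_apply, (H.hasDerivAt_support hp hdim hinj hmin).deriv, real_inner_smul_left,
    real_inner_smul_left, real_inner_self_eq_norm_sq]
  field

theorem meanCurvature_mul_support_lt (H : IsNormalFlow W f ν S) (hp : p ∈ W)
    (b : Module.Basis ι ℝ F) (hdim : Module.finrank ℝ E = Fintype.card ι + 1)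
    (hinj : Function.Injective (fderivFst f p))
    (hpos : ∀ v, v ≠ 0 → 0 < ⟪fderivFst f p v, fderivFst ν p v⟫)
    (hS : 0 < S p) (hu : 0 < ⟪f p, ν p⟫)
    (hlaw : ∀ x ∈ W, S x * (‖f x‖ ^ Module.finrank ℝ E *
      gaussKronecker b (fderivFst f x) (fderivFst ν x)) = ⟪f x, ν x⟫ ^ (Module.finrank ℝ E + 2))
    (hmin : IsLocalMinOn
      (fun x => S x - ⟪((Module.finrank ℝ E + 1) * S p / ‖f p‖ ^ 2) • f p, f x⟫)
      {x | x.2 ≤ p.2} p) :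
    meanCurvature b (fderivFst f p) (fderivFst ν p) * ⟪f p, ν p⟫ <
      Module.finrank ℝ E * (Module.finrank ℝ E + 2) := by
  have hdimF : Module.finrank ℝ E = Module.finrank ℝ F + 1 := by
    rw [hdim, Module.finrank_eq_card_basis b]
  have hcard : (Fintype.card ι : ℝ) = Module.finrank ℝ E - 1 := by rw [hdim]; push_cast; ring
  have hf0 : f p ≠ 0 := fun h => by simp [h] at hu
  have hr : 0 < ‖f p‖ := norm_pos_iff.2 hf0
  have hK : gaussKronecker b (fderivFst f p) (fderivFst ν p) ≠ 0 :=
    div_ne_zero (posDef_toMatrix_pairing b (H.isSymm_pairing hp) hpos).det_pos.ne'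
      (posDef_toMatrix_pairing_self b hinj).det_pos.ne'
  set e := ((Module.finrank ℝ E + 1) * S p / ‖f p‖ ^ 2) • f p
  have heν : ⟪e, ν p⟫ = (Module.finrank ℝ E + 1) * (S p * (⟪f p, ν p⟫ / ‖f p‖ ^ 2)) := by
    rw [real_inner_smul_left]
    ring
  have hlog := H.logDeriv_speed_add_logDeriv_gaussKronecker hp b hinj hS.ne' hf0 hK hlaw
  have hlogS := H.logDeriv_speed_le hp hS hmin
  have hlogK := H.logDeriv_gaussKronecker_le hp b hdimF hinj hpos hmin
  have hlogu := H.logDeriv_support hp hdimF hinj hu.ne' hmin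
  rw [add_sub_cancel_right] at hlogu
  rw [H.logDeriv_norm hp hf0, hlogu, mul_div_assoc] at hlog
  rw [heν] at hlogS hlogK
  rw [hcard] at hlogK
  push_cast at hlog
  set N := (Module.finrank ℝ E : ℝ)
  set u := ⟪f p, ν p⟫
  set k := meanCurvature b (fderivFst f p) (fderivFst ν p)
  have hk : k ≤ N * (N + 2) / u - (N + 2) * (u / ‖f p‖ ^ 2) := by
    refine le_of_mul_le_mul_left ?_ hS
    linear_combination hlogK + hlogS - hlog
  calc k * u < N * (N + 2) / u * u := by
        refine mul_lt_mul_of_pos_right (hk.trans_lt (sub_lt_self _ ?_)) hu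
        exact mul_pos (by positivity) (div_pos hu (pow_pos hr 2))
    _ = N * (N + 2) := div_mul_cancel₀ _ hu.ne'

variable [Nonempty ι]

theorem lt_sharpThreshold_of_norm_pow_le (H : IsNormalFlow W f ν S) (hp : p ∈ W)
    (b : Module.Basis ι ℝ F) (hdim : Module.finrank ℝ E = Fintype.card ι + 1)
    (hinj : Function.Injective (fderivFst f p))
    (hpos : ∀ v, v ≠ 0 → 0 < ⟪fderivFst f p v, fderivFst ν p v⟫) (hf0 : f p ≠ 0)
    (hlaw : ∀ x ∈ W, S x * (‖f x‖ ^ Module.finrank ℝ E *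
      gaussKronecker b (fderivFst f x) (fderivFst ν x)) = ⟪f x, ν x⟫ ^ (Module.finrank ℝ E + 2))
    {γ lam : ℝ} (hγ : 0 < γ) (hangle : γ * ‖f p‖ ≤ ⟪f p, ν p⟫) (hlam : 0 < lam)
    (heq : ‖f p‖ ^ (Module.finrank ℝ E + 1) = lam * S p)
    (hle : ∀ᶠ x in 𝓝[{x | x.2 ≤ p.2}] p, ‖f x‖ ^ (Module.finrank ℝ E + 1) ≤ lam * S x) :
    lam < sharpThreshold (Module.finrank ℝ E) γ := by
  have hr : 0 < ‖f p‖ := norm_pos_iff.2 hf0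
  have hu : 0 < ⟪f p, ν p⟫ := (mul_pos hγ hr).trans_le hangle
  have hS : 0 < S p := pos_of_mul_pos_right (heq ▸ pow_pos hr _) hlam.le
  have hmin := isLocalMinOn_sub_inner_of_norm_pow_le hf0 hlam heq hle
  push_cast at hmin
  have hg := posDef_toMatrix_pairing_self b hinj
  have hh := (posDef_toMatrix_pairing b (H.isSymm_pairing hp) hpos).posSemidef
  have hcurv := H.meanCurvature_mul_support_lt hp b hdim hinj hpos hS hu hlaw hmin
  have hspeed := hlaw p hp
  rw [hdim] at heq hspeed hcurv ⊢
  push_cast at hcurv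
  refine lt_sharpThreshold Fintype.card_pos hγ hr hangle hlam.le
    (trace_mul_nonneg hg.inv.posSemidef hh) (card_pow_mul_det_div_det_le_trace_pow hg hh)
    (hcurv.trans_eq (by ring)) (mul_left_cancel₀ hS.ne' ?_)
  calc S p * (lam * ⟪f p, ν p⟫ ^ (Fintype.card ι + 3))
      = lam * S p * ⟪f p, ν p⟫ ^ (Fintype.card ι + 3) := by ring
    _ = _ := by
        rw [← heq, ← hspeed, gaussKronecker]
        ring

end IsNormalFlow

end NormalFlow

section SmoothNormal

variable {X F E : Type*} [NormedAddCommGroup X] [NormedSpace ℝ X] [NormedAddCommGroup F]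
  [NormedSpace ℝ F] [NormedAddCommGroup E] [InnerProductSpace ℝ E] {k : WithTop ℕ∞}

theorem contDiffOn_gaussKronecker {ι : Type*} [Fintype ι] [DecidableEq ι]
    (b : Module.Basis ι ℝ F) {P Q : X → F →ₗ[ℝ] E} {s : Set X}
    (hP : ∀ v, ContDiffOn ℝ k (fun x => P x v) s) (hQ : ∀ v, ContDiffOn ℝ k (fun x => Q x v) s)
    (hinj : ∀ x ∈ s, Function.Injective (P x)) :
    ContDiffOn ℝ k (fun x => gaussKronecker b (P x) (Q x)) s := by
  have hdet (R : X → F →ₗ[ℝ] E) (hR : ∀ v, ContDiffOn ℝ k (fun x => R x v) s) :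
      ContDiffOn ℝ k (fun x => ((pairing (P x) (R x)).toMatrix b).det) s := by
    simp only [Matrix.det_apply, LinearMap.BilinForm.toMatrix_apply, pairing_apply]
    exact ContDiffOn.sum fun σ _ => (contDiffOn_prod fun i _ =>
      (hP _).inner ℝ (hR _)).const_smul _
  exact (hdet Q hQ).div (hdet P hP) fun x hx =>
    (posDef_toMatrix_pairing_self b (hinj x hx)).det_pos.ne'

theorem exists_equiv_eq_coprod_toSpanSingleton [FiniteDimensional ℝ E] [FiniteDimensional ℝ F]
    {P : F →L[ℝ] E} {y ν : E} (hdim : Module.finrank ℝ E = Module.finrank ℝ F + 1)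
    (hP : Function.Injective P) (hperp : ∀ v, ⟪P v, ν⟫ = 0) (hy : ⟪y, ν⟫ ≠ 0) :
    ∃ e : (F × ℝ) ≃L[ℝ] E, (e : F × ℝ →L[ℝ] E) = P.coprod (.toSpanSingleton ℝ y) := by
  have hinj : Function.Injective (P.coprod (.toSpanSingleton ℝ y)) := by
    refine (injective_iff_map_eq_zero _).2 fun ⟨v, c⟩ hvc => ?_
    have hsum : P v + c • y = 0 := by simpa using hvc
    have hc : c = 0 := by
      have := congrArg (fun z => ⟪z, ν⟫) hsum
      simpa [inner_add_left, real_inner_smul_left, hperp, hy] using this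
    rw [hc, zero_smul, add_zero] at hsum
    rw [hc, (map_eq_zero_iff P hP).1 hsum, Prod.mk_zero_zero]
  have hfinrank : Module.finrank ℝ (F × ℝ) = Module.finrank ℝ E := by
    rw [Module.finrank_prod, Module.finrank_self, hdim]
  exact ⟨(LinearEquiv.ofInjectiveOfFinrankEq _ hinj hfinrank).toContinuousLinearEquiv,
    by ext <;> rfl⟩

theorem toDual_inv_inner_smul_eq_comp_symm [CompleteSpace E] {P : F →L[ℝ] E} {y ν : E}
    {e : (F × ℝ) ≃L[ℝ] E} (he : (e : F × ℝ →L[ℝ] E) = P.coprod (.toSpanSingleton ℝ y))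
    (hperp : ∀ v, ⟪P v, ν⟫ = 0) (hy : ⟪y, ν⟫ ≠ 0) :
    InnerProductSpace.toDual ℝ E (⟪y, ν⟫⁻¹ • ν) =
      (ContinuousLinearMap.snd ℝ F ℝ).comp (e.symm : E →L[ℝ] F × ℝ) := by
  ext z
  obtain ⟨⟨v, c⟩, rfl⟩ := e.surjective z
  have hvc : e (v, c) = P v + c • y := by simpa using congrArg (fun L => L (v, c)) he
  have hinner : ⟪ν, P v + c • y⟫ = c * ⟪y, ν⟫ := by
    rw [real_inner_comm, inner_add_left, hperp, real_inner_smul_left, zero_add]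
  simp only [InnerProductSpace.toDual_apply_apply, ContinuousLinearMap.comp_apply,
    ContinuousLinearEquiv.coe_coe, ContinuousLinearEquiv.symm_apply_apply,
    ContinuousLinearMap.coe_snd', real_inner_smul_left]
  rw [hvc, hinner]
  field

theorem contDiffOn_inv_inner_smul_normal [FiniteDimensional ℝ E] [FiniteDimensional ℝ F]
    {f ν : X → E} {P : X → F →L[ℝ] E} {s : Set X}
    (hdim : Module.finrank ℝ E = Module.finrank ℝ F + 1) (hf : ContDiffOn ℝ k f s)
    (hP : ContDiffOn ℝ k P s) (hinj : ∀ x ∈ s, Function.Injective (P x))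
    (hperp : ∀ x ∈ s, ∀ v, ⟪P x v, ν x⟫ = 0) (hsupport : ∀ x ∈ s, ⟪f x, ν x⟫ ≠ 0) :
    ContDiffOn ℝ k (fun x => ⟪f x, ν x⟫⁻¹ • ν x) s := by
  -- The functional `⟪·, ν / ⟪f, ν⟫⟫` vanishes on the range of `P` and is `1` at `f`: it is the last
  -- component of the inverse of `(v, c) ↦ P v + c • f`, and inversion is smooth.
  let B (x : X) : F × ℝ →L[ℝ] E := (P x).coprod (.toSpanSingleton ℝ (f x))
  have hB : ContDiffOn ℝ k B s := contDiffOn_clm_apply.2 fun ⟨v, c⟩ => by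
    simpa [B] using (hP.clm_apply contDiffOn_const).add (hf.const_smul c)
  have hinverse : ContDiffOn ℝ k (fun x => (B x).inverse) s := fun x hx => by
    obtain ⟨e, he⟩ := exists_equiv_eq_coprod_toSpanSingleton hdim (hinj x hx) (hperp x hx)
      (hsupport x hx)
    have hmap := contDiffAt_map_inverse (𝕜 := ℝ) (n := k) e
    rw [he] at hmap
    exact hmap.comp_contDiffWithinAt x (hB x hx)
  refine ((InnerProductSpace.toDual ℝ E).symm.contDiff.comp_contDiffOn
    ((contDiffOn_const (c := ContinuousLinearMap.snd ℝ F ℝ)).clm_comp hinverse)).congr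
    fun x hx => ?_
  obtain ⟨e, he⟩ := exists_equiv_eq_coprod_toSpanSingleton hdim (hinj x hx) (hperp x hx)
    (hsupport x hx)
  rw [Function.comp_apply, LinearIsometryEquiv.eq_symm_apply,
    toDual_inv_inner_smul_eq_comp_symm he (hperp x hx) (hsupport x hx),
    ← ContinuousLinearMap.inverse_equiv, he]

theorem contDiffOn_normal [FiniteDimensional ℝ E] [FiniteDimensional ℝ F]
    {f ν : X → E} {P : X → F →L[ℝ] E} {s : Set X}
    (hdim : Module.finrank ℝ E = Module.finrank ℝ F + 1) (hf : ContDiffOn ℝ k f s)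
    (hP : ContDiffOn ℝ k P s) (hinj : ∀ x ∈ s, Function.Injective (P x))
    (hperp : ∀ x ∈ s, ∀ v, ⟪P x v, ν x⟫ = 0) (hnorm : ∀ x ∈ s, ‖ν x‖ = 1)
    (hsupport : ∀ x ∈ s, 0 < ⟪f x, ν x⟫) : ContDiffOn ℝ k ν s := by
  have hw := contDiffOn_inv_inner_smul_normal hdim hf hP hinj hperp fun x hx =>
    (hsupport x hx).ne'
  have hwnorm (x : X) (hx : x ∈ s) : ‖⟪f x, ν x⟫⁻¹ • ν x‖ = ⟪f x, ν x⟫⁻¹ := by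
    rw [norm_smul, hnorm x hx, mul_one, Real.norm_of_nonneg (inv_nonneg.2 (hsupport x hx).le)]
  have hwpos (x : X) (hx : x ∈ s) : 0 < ‖⟪f x, ν x⟫⁻¹ • ν x‖ := by
    rw [hwnorm x hx]
    exact inv_pos.2 (hsupport x hx)
  refine (((hw.norm ℝ fun x hx => norm_pos_iff.1 (hwpos x hx)).inv fun x hx =>
    (hwpos x hx).ne').smul hw).congr fun x hx => ?_
  rw [Pi.smul_apply', Pi.inv_apply, hwnorm x hx, inv_inv, smul_inv_smul₀ (hsupport x hx).ne']

end SmoothNormal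

section Charts

variable {n : ℕ} {M : Type*} [TopologicalSpace M]
  [ChartedSpace (EuclideanSpace ℝ (Fin (n - 1))) M]

/-- The standard basis of the model space `ℝⁿ⁻¹`, in which `coordVec` lists the coordinate
vectors. -/
noncomputable def stdBasis (n : ℕ) :
    Module.Basis (Fin (n - 1)) ℝ (EuclideanSpace ℝ (Fin (n - 1))) :=
  (EuclideanSpace.basisFun (Fin (n - 1)) ℝ).toBasis

theorem stdBasis_apply (x : M) (i : Fin (n - 1)) : stdBasis n i = coordVec x i := by
  simp [stdBasis, coordVec]

/-- A time dependent map in the preferred coordinates around `x₀`, as a function on space-time. -/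
noncomputable def inChart (x₀ : M) (φ : M → ℝ → EuclideanSpace ℝ (Fin n))
    (p : EuclideanSpace ℝ (Fin (n - 1)) × ℝ) : EuclideanSpace ℝ (Fin n) :=
  φ ((extChartAt (𝓡 (n - 1)) x₀).symm p.1) p.2

/-- The part of space-time `M × [0, T)` covered by the preferred coordinates around `x₀`. -/
def chartSlab (T : ℝ) (x₀ : M) : Set (EuclideanSpace ℝ (Fin (n - 1)) × ℝ) :=
  (extChartAt (𝓡 (n - 1)) x₀).target ×ˢ Ico 0 T

variable {x₀ x : M} {T t : ℝ} {φ : M → ℝ → EuclideanSpace ℝ (Fin n)}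

theorem inChart_apply (φ : M → ℝ → EuclideanSpace ℝ (Fin n))
    (hx : x ∈ (extChartAt (𝓡 (n - 1)) x₀).source) (t : ℝ) :
    inChart x₀ φ (extChartAt (𝓡 (n - 1)) x₀ x, t) = φ x t := by
  simp only [inChart, (extChartAt (𝓡 (n - 1)) x₀).left_inv hx]

theorem mem_chartSlab (hx : x ∈ (extChartAt (𝓡 (n - 1)) x₀).source) (ht : t ∈ Ico 0 T) :
    (extChartAt (𝓡 (n - 1)) x₀ x, t) ∈ chartSlab T x₀ :=
  ⟨(extChartAt (𝓡 (n - 1)) x₀).map_source hx, ht⟩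

theorem exists_eq_of_mem_chartSlab {p : EuclideanSpace ℝ (Fin (n - 1)) × ℝ}
    (hp : p ∈ chartSlab T x₀) : ∃ x ∈ (extChartAt (𝓡 (n - 1)) x₀).source, ∃ t ∈ Ico 0 T,
      (extChartAt (𝓡 (n - 1)) x₀ x, t) = p :=
  ⟨_, (extChartAt (𝓡 (n - 1)) x₀).map_target hp.1, p.2, hp.2,
    Prod.ext ((extChartAt (𝓡 (n - 1)) x₀).right_inv hp.1) rfl⟩

theorem prod_Ioo_subset_chartSlab :
    (extChartAt (𝓡 (n - 1)) x₀).target ×ˢ Ioo 0 T ⊆ chartSlab T x₀ :=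
  prod_mono_right Ioo_subset_Ico_self

theorem chartSlab_mem_nhds {p : EuclideanSpace ℝ (Fin (n - 1)) × ℝ}
    (hp : p ∈ (extChartAt (𝓡 (n - 1)) x₀).target ×ˢ Ioo 0 T) : chartSlab T x₀ ∈ 𝓝 p :=
  mem_of_superset (((isOpen_extChartAt_target x₀).prod isOpen_Ioo).mem_nhds hp)
    prod_Ioo_subset_chartSlab

variable [IsManifold (𝓡 (n - 1)) ∞ M]

theorem contDiffOn_inChart
    (hφ : ContMDiffOn ((𝓡 (n - 1)).prod 𝓘(ℝ, ℝ)) 𝓘(ℝ, EuclideanSpace ℝ (Fin n)) ∞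
      (fun p : M × ℝ => φ p.1 p.2) (univ ×ˢ Ico 0 T)) (x₀ : M) :
    ContDiffOn ℝ ∞ (inChart x₀ φ) (chartSlab T x₀) := by
  have hchart : ContMDiffOn (𝓘(ℝ, EuclideanSpace ℝ (Fin (n - 1))).prod 𝓘(ℝ, ℝ))
      ((𝓡 (n - 1)).prod 𝓘(ℝ, ℝ)) ∞
      (Prod.map (extChartAt (𝓡 (n - 1)) x₀).symm (id : ℝ → ℝ)) (chartSlab T x₀) :=
    (contMDiffOn_extChartAt_symm x₀).prodMap contMDiffOn_id
  have hcomp := hφ.comp hchart fun p hp => ⟨mem_univ _, hp.2⟩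
  rw [← modelWithCornersSelf_prod, chartedSpaceSelf_prod, contMDiffOn_iff_contDiffOn] at hcomp
  exact hcomp

theorem bijective_mfderiv_extChartAt (hx : x ∈ (extChartAt (𝓡 (n - 1)) x₀).source) :
    Function.Bijective (mfderiv (𝓡 (n - 1)) 𝓘(ℝ, EuclideanSpace ℝ (Fin (n - 1)))
      (extChartAt (𝓡 (n - 1)) x₀) x) := by
  have : IsManifold (𝓡 (n - 1)) 1 M := IsManifold.of_le (n := ∞) (by simp)
  exact (isInvertible_mfderiv_extChartAt hx).bijective

theorem diff_eq_fderivFst_inChart (hx : x ∈ (extChartAt (𝓡 (n - 1)) x₀).source)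
    (hφ : ContDiffOn ℝ ∞ (inChart x₀ φ) (chartSlab T x₀)) (ht : t ∈ Ico 0 T)
    (v : TangentSpace (𝓡 (n - 1)) x) :
    diff (fun y => φ y t) x v = fderivFst (inChart x₀ φ) (extChartAt (𝓡 (n - 1)) x₀ x, t)
      (mfderiv (𝓡 (n - 1)) 𝓘(ℝ, EuclideanSpace ℝ (Fin (n - 1)))
        (extChartAt (𝓡 (n - 1)) x₀) x v) := by
  have : IsManifold (𝓡 (n - 1)) 1 M := IsManifold.of_le (n := ∞) (by simp)
  have hslice := hasFDerivAt_slice (isOpen_extChartAt_target x₀) (hφ.differentiableOn (by simp))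
    (mem_chartSlab hx ht)
  have hchart := mdifferentiableAt_extChartAt (I := 𝓡 (n - 1)) (x := x₀) (y := x)
    (by rwa [extChartAt_source] at hx)
  have hfactor : (fun y => φ y t) =ᶠ[𝓝 x]
      (fun z => inChart x₀ φ (z, t)) ∘ extChartAt (𝓡 (n - 1)) x₀ := by
    filter_upwards [extChartAt_source_mem_nhds' hx] with y hy
    exact (inChart_apply φ hy t).symm
  have hcomp := hslice.differentiableAt.hasFDerivAt.hasMFDerivAt.comp x hchart.hasMFDerivAt
  rw [diff, (hcomp.congr_of_eventuallyEq hfactor).mfderiv]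
  rfl

theorem gaussCurvature_eq_gaussKronecker {ν : M → ℝ → EuclideanSpace ℝ (Fin n)}
    (hx : x ∈ (extChartAt (𝓡 (n - 1)) x₀).source)
    (hφ : ContDiffOn ℝ ∞ (inChart x₀ φ) (chartSlab T x₀))
    (hν : ContDiffOn ℝ ∞ (inChart x₀ ν) (chartSlab T x₀)) (ht : t ∈ Ico 0 T) :
    gaussCurvature (fun y => φ y t) (fun y => ν y t) x =
      gaussKronecker (stdBasis n) (fderivFst (inChart x₀ φ) (extChartAt (𝓡 (n - 1)) x₀ x, t))
        (fderivFst (inChart x₀ ν) (extChartAt (𝓡 (n - 1)) x₀ x, t)) := by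
  rw [← gaussKronecker_comp (stdBasis n) _ _ (bijective_mfderiv_extChartAt hx),
    gaussCurvature, gaussKronecker]
  congr 2 <;> ext i j <;>
    simp only [secondForm, firstForm, Matrix.of_apply, LinearMap.BilinForm.toMatrix_apply,
      diff_eq_fderivFst_inChart hx hφ ht, diff_eq_fderivFst_inChart hx hν ht,
      stdBasis_apply x] <;> rfl

/-- The speed of the flow in the preferred coordinates around `x₀`, as a function on space-time. -/
noncomputable def chartSpeed (φ ν : M → ℝ → EuclideanSpace ℝ (Fin n)) (x₀ : M)
    (p : EuclideanSpace ℝ (Fin (n - 1)) × ℝ) : ℝ :=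
  ⟪inChart x₀ φ p, inChart x₀ ν p⟫ ^ (n + 2) / ‖inChart x₀ φ p‖ ^ n *
    (1 / gaussKronecker (stdBasis n) (fderivFst (inChart x₀ φ) p) (fderivFst (inChart x₀ ν) p))

end Charts

namespace IsStrictlyConvexBoundary

variable {n : ℕ} {M : Type*} [TopologicalSpace M]
  [ChartedSpace (EuclideanSpace ℝ (Fin (n - 1))) M] {f ν : M → EuclideanSpace ℝ (Fin n)}

theorem norm_normal (h : IsStrictlyConvexBoundary f ν) (x : M) : ‖ν x‖ = 1 := by
  obtain ⟨K, -, -, hK⟩ := h.body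
  exact (hK x).1

theorem inner_le (h : IsStrictlyConvexBoundary f ν) (x y : M) : ⟪f y, ν x⟫ ≤ ⟪f x, ν x⟫ := by
  obtain ⟨K, -, hrange, hK⟩ := h.body
  have hy : f y ∈ frontier (K : Set (EuclideanSpace ℝ (Fin n))) := hrange ▸ mem_range_self y
  have hle := (hK x).2 (f y) (K.isClosed.frontier_subset hy)
  rwa [inner_sub_left, sub_nonpos] at hle

theorem support_pos (h : IsStrictlyConvexBoundary f ν) (x : M) : 0 < ⟪f x, ν x⟫ := by
  obtain ⟨K, hzero, -, hK⟩ := h.body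
  obtain ⟨ε, hε, hball⟩ := Metric.isOpen_iff.1 isOpen_interior 0 hzero
  have hmem : (ε / 2) • ν x ∈ K := by
    refine interior_subset (hball ?_)
    rw [mem_ball_zero_iff, norm_smul, h.norm_normal, Real.norm_of_nonneg (by positivity)]
    linarith
  have hle := (hK x).2 _ hmem
  rw [inner_sub_left, real_inner_smul_left, real_inner_self_eq_norm_sq, h.norm_normal] at hle
  linarith

theorem ne_zero (h : IsStrictlyConvexBoundary f ν) (x : M) : f x ≠ 0 := fun hx =>
  (h.support_pos x).ne' (by rw [hx, inner_zero_left])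

theorem dim_pos (h : IsStrictlyConvexBoundary f ν) (x : M) : 0 < n := by
  refine Nat.pos_of_ne_zero ?_
  rintro rfl
  exact h.ne_zero x (Subsingleton.elim _ _)

theorem support_le_norm (h : IsStrictlyConvexBoundary f ν) (x : M) : ⟪f x, ν x⟫ ≤ ‖f x‖ := by
  simpa [h.norm_normal x] using real_inner_le_norm (f x) (ν x)

end IsStrictlyConvexBoundary

section FirstZero

variable {X : Type*} [TopologicalSpace X] [CompactSpace X] {u : X × ℝ → ℝ} {T : ℝ}

theorem exists_first_nonneg (hu : ContinuousOn u (univ ×ˢ Ico 0 T)) (hinit : ∀ x, u (x, 0) < 0)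
    (hcross : ∃ t ∈ Ico 0 T, ∃ x, 0 ≤ u (x, t)) :
    ∃ t₀ ∈ Ioo 0 T, (∃ x, 0 ≤ u (x, t₀)) ∧ ∀ t ∈ Ico 0 t₀, ∀ x, u (x, t) < 0 := by
  obtain ⟨t₁, ht₁, x₁, hx₁⟩ := hcross
  have hslab : ContinuousOn u (univ ×ˢ Icc 0 t₁) :=
    hu.mono (prod_mono_right fun t ht => ⟨ht.1, ht.2.trans_lt ht₁.2⟩)
  have hcompact : IsCompact ((univ : Set X) ×ˢ Icc 0 t₁ ∩ u ⁻¹' Ici 0) :=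
    (isCompact_univ.prod isCompact_Icc).of_isClosed_subset
      (hslab.preimage_isClosed_of_isClosed (isClosed_univ.prod isClosed_Icc) isClosed_Ici)
      inter_subset_left
  obtain ⟨⟨x₀, t₀⟩, ⟨⟨-, ht₀⟩, hx₀⟩, hfirst⟩ :=
    hcompact.exists_isMinOn ⟨(x₁, t₁), ⟨mem_univ _, ht₁.1, le_rfl⟩, hx₁⟩ continuousOn_snd
  have hpos : 0 < t₀ := ht₀.1.lt_of_ne fun h => (hinit x₀).not_ge (h ▸ hx₀)
  refine ⟨t₀, ⟨hpos, ht₀.2.trans_lt ht₁.2⟩, ⟨x₀, hx₀⟩, fun t ht x => ?_⟩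
  by_contra! hx
  exact ht.2.not_ge
    (isMinOn_iff.1 hfirst (x, t) ⟨⟨mem_univ _, ht.1, ht.2.le.trans ht₀.2⟩, hx⟩)

theorem exists_first_zero (hu : ContinuousOn u (univ ×ˢ Ico 0 T)) (hinit : ∀ x, u (x, 0) < 0)
    (hcross : ∃ t ∈ Ico 0 T, ∃ x, 0 ≤ u (x, t)) :
    ∃ t₀ ∈ Ioo 0 T, (∃ x, u (x, t₀) = 0) ∧ ∀ t ∈ Icc 0 t₀, ∀ x, u (x, t) ≤ 0 := by
  obtain ⟨t₀, ht₀, ⟨x₀, hx₀⟩, hbefore⟩ := exists_first_nonneg hu hinit hcross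
  have hnonpos (t : ℝ) (ht : t ∈ Icc 0 t₀) (x : X) : u (x, t) ≤ 0 := by
    rw [← closure_Ico ht₀.1.ne] at ht
    refine ContinuousWithinAt.closure_le ht (f := fun s => u (x, s)) ?_
      continuousWithinAt_const fun s hs => (hbefore s hs x).le
    rw [closure_Ico ht₀.1.ne] at ht
    exact (hu (x, t) ⟨mem_univ x, ht.1, ht.2.trans_lt ht₀.2⟩).comp
      (Continuous.prodMk_right x).continuousWithinAt
      fun s hs => ⟨mem_univ x, hs.1, hs.2.trans ht₀.2⟩
  exact ⟨t₀, ht₀, ⟨x₀, (hnonpos t₀ (right_mem_Icc.2 ht₀.1.le) x₀).antisymm hx₀⟩, hnonpos⟩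

end FirstZero

namespace IsDualFlow

variable {n : ℕ} {M : Type*} [TopologicalSpace M]
  [ChartedSpace (EuclideanSpace ℝ (Fin (n - 1))) M] [IsManifold (𝓡 (n - 1)) ∞ M]
  {T t : ℝ} {φ ν : M → ℝ → EuclideanSpace ℝ (Fin n)} {x₀ x : M}
  {p : EuclideanSpace ℝ (Fin (n - 1)) × ℝ}

theorem contDiffOn_map (H : IsDualFlow T φ ν) (x₀ : M) :
    ContDiffOn ℝ ∞ (inChart x₀ φ) (chartSlab T x₀) :=
  contDiffOn_inChart H.smooth x₀

omit [IsManifold (𝓡 (n - 1)) ∞ M] in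
theorem finrank_eq (H : IsDualFlow T φ ν) (hp : p ∈ chartSlab T x₀) :
    Module.finrank ℝ (EuclideanSpace ℝ (Fin n)) =
      Module.finrank ℝ (EuclideanSpace ℝ (Fin (n - 1))) + 1 := by
  rw [finrank_euclideanSpace_fin, finrank_euclideanSpace_fin,
    Nat.sub_add_cancel ((H.convex p.2 hp.2).dim_pos x₀)]

theorem inner_fderivFst_normal (H : IsDualFlow T φ ν) (hp : p ∈ chartSlab T x₀)
    (v : EuclideanSpace ℝ (Fin (n - 1))) :
    ⟪fderivFst (inChart x₀ φ) p v, inChart x₀ ν p⟫ = 0 := by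
  have hslice := hasFDerivAt_slice (isOpen_extChartAt_target x₀)
    ((H.contDiffOn_map x₀).differentiableOn (by simp)) hp
  have hmax : IsLocalMax (fun y => ⟪inChart x₀ φ (y, p.2), inChart x₀ ν p⟫) p.1 :=
    Eventually.of_forall fun _ => (H.convex p.2 hp.2).inner_le _ _
  have hzero := fderiv_inner_apply ℝ hslice.differentiableAt
    (differentiableAt_const (inChart x₀ ν p)) v
  rw [hmax.fderiv_eq_zero] at hzero
  change ⟪fderiv ℝ (fun y => inChart x₀ φ (y, p.2)) p.1 v, _⟫ = 0
  simpa using hzero.symm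

theorem injective_fderivFst (H : IsDualFlow T φ ν) (hp : p ∈ chartSlab T x₀) :
    Function.Injective (fderivFst (inChart x₀ φ) p) := by
  obtain ⟨x, hx, t, ht, rfl⟩ := exists_eq_of_mem_chartSlab hp
  refine (injective_iff_map_eq_zero _).2 fun w hw => ?_
  obtain ⟨v, rfl⟩ := (bijective_mfderiv_extChartAt hx).2 w
  have hdiff : diff (fun y => φ y t) x v = 0 :=
    (diff_eq_fderivFst_inChart hx (H.contDiffOn_map x₀) ht v).trans hw
  have hv : v = 0 := (H.convex t ht).immersion x (hdiff.trans (map_zero _).symm)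
  rw [hv]
  exact map_zero _

theorem contDiffOn_normal (H : IsDualFlow T φ ν) (x₀ : M) :
    ContDiffOn ℝ ∞ (inChart x₀ ν) (chartSlab T x₀) := fun p hp =>
  DualFlow.contDiffOn_normal (H.finrank_eq hp) (H.contDiffOn_map x₀)
    (contDiffOn_fderiv_slice (isOpen_extChartAt_target x₀) (uniqueDiffOn_Ico 0 T)
      (H.contDiffOn_map x₀) (by simp))
    (fun _ hq => H.injective_fderivFst hq) (fun _ hq => H.inner_fderivFst_normal hq)
    (fun q hq => (H.convex q.2 hq.2).norm_normal _)
    (fun q hq => (H.convex q.2 hq.2).support_pos _) p hp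

theorem inner_fderivFst_pos (H : IsDualFlow T φ ν) (hp : p ∈ chartSlab T x₀)
    {w : EuclideanSpace ℝ (Fin (n - 1))} (hw : w ≠ 0) :
    0 < ⟪fderivFst (inChart x₀ φ) p w, fderivFst (inChart x₀ ν) p w⟫ := by
  obtain ⟨x, hx, t, ht, rfl⟩ := exists_eq_of_mem_chartSlab hp
  obtain ⟨v, rfl⟩ := (bijective_mfderiv_extChartAt hx).2 w
  have hv : v ≠ 0 := fun h => hw (by rw [h]; exact map_zero _)
  have hpos := (H.convex t ht).strictly_convex x v hv
  rwa [diff_eq_fderivFst_inChart hx (H.contDiffOn_map x₀) ht,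
    diff_eq_fderivFst_inChart hx (H.contDiffOn_normal x₀) ht] at hpos

theorem isSymm_pairing (H : IsDualFlow T φ ν) (hp : p ∈ chartSlab T x₀) :
    (pairing (fderivFst (inChart x₀ φ) p) (fderivFst (inChart x₀ ν) p)).IsSymm := by
  have hU := isOpen_extChartAt_target (I := 𝓡 (n - 1)) x₀
  have hmap : ContDiffAt ℝ ∞ (fun y => inChart x₀ φ (y, p.2)) p.1 :=
    ((H.contDiffOn_map x₀).comp (contDiff_prodMk_left p.2).contDiffOn
      fun y hy => ⟨hy, hp.2⟩).contDiffAt (hU.mem_nhds hp.1)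
  have hnormal := (hasFDerivAt_slice hU
    ((H.contDiffOn_normal x₀).differentiableOn (by simp)) hp).differentiableAt
  have hperp (v : EuclideanSpace ℝ (Fin (n - 1))) : ∀ᶠ y in 𝓝 p.1,
      ⟪fderiv ℝ (fun z => inChart x₀ φ (z, p.2)) y v, inChart x₀ ν (y, p.2)⟫ = 0 :=
    (hU.eventually_mem hp.1).mono fun y hy =>
      H.inner_fderivFst_normal (p := (y, p.2)) ⟨hy, hp.2⟩ v
  exact ⟨fun v w => inner_fderiv_fderiv_comm (hmap.of_le ENat.LEInfty.out) hnormal (hperp v)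
    (hperp w)⟩

theorem gaussKronecker_pos (H : IsDualFlow T φ ν) (hp : p ∈ chartSlab T x₀) :
    0 < gaussKronecker (stdBasis n) (fderivFst (inChart x₀ φ) p) (fderivFst (inChart x₀ ν) p) :=
  div_pos (posDef_toMatrix_pairing _ (H.isSymm_pairing hp) fun _ hv =>
      H.inner_fderivFst_pos hp hv).det_pos
    (posDef_toMatrix_pairing_self _ (H.injective_fderivFst hp)).det_pos

theorem gaussCurvature_eq (H : IsDualFlow T φ ν) (hx : x ∈ (extChartAt (𝓡 (n - 1)) x₀).source)
    (ht : t ∈ Ico 0 T) : gaussCurvature (fun y => φ y t) (fun y => ν y t) x =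
      gaussKronecker (stdBasis n) (fderivFst (inChart x₀ φ) (extChartAt (𝓡 (n - 1)) x₀ x, t))
        (fderivFst (inChart x₀ ν) (extChartAt (𝓡 (n - 1)) x₀ x, t)) :=
  gaussCurvature_eq_gaussKronecker hx (H.contDiffOn_map x₀) (H.contDiffOn_normal x₀) ht

theorem gaussCurvature_pos (H : IsDualFlow T φ ν) (ht : t ∈ Ico 0 T) (x : M) :
    0 < gaussCurvature (fun y => φ y t) (fun y => ν y t) x := by
  have hx := mem_extChartAt_source (I := 𝓡 (n - 1)) x
  rw [H.gaussCurvature_eq hx ht]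
  exact H.gaussKronecker_pos (mem_chartSlab hx ht)

theorem speed_pos (H : IsDualFlow T φ ν) (ht : t ∈ Ico 0 T) (x : M) :
    0 < speed (fun y => φ y t) (fun y => ν y t) x := by
  have hK := H.gaussCurvature_pos ht x
  have hu := (H.convex t ht).support_pos x
  have hr : 0 < ‖φ x t‖ := norm_pos_iff.2 ((H.convex t ht).ne_zero x)
  rw [speed]
  positivity

theorem speed_eq_chartSpeed (H : IsDualFlow T φ ν)
    (hx : x ∈ (extChartAt (𝓡 (n - 1)) x₀).source) (ht : t ∈ Ico 0 T) :
    speed (fun y => φ y t) (fun y => ν y t) x =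
      chartSpeed φ ν x₀ (extChartAt (𝓡 (n - 1)) x₀ x, t) := by
  rw [speed, chartSpeed, H.gaussCurvature_eq hx ht, inChart_apply φ hx, inChart_apply ν hx]

theorem chi_eq_inChart (H : IsDualFlow T φ ν) (lam : ℝ)
    (hx : x ∈ (extChartAt (𝓡 (n - 1)) x₀).source) (ht : t ∈ Ico 0 T) :
    chi lam (fun y => φ y t) (fun y => ν y t) x =
      ‖inChart x₀ φ (extChartAt (𝓡 (n - 1)) x₀ x, t)‖ ^ (n + 1) -
        lam * chartSpeed φ ν x₀ (extChartAt (𝓡 (n - 1)) x₀ x, t) := by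
  rw [chi, H.speed_eq_chartSpeed hx ht, inChart_apply φ hx]

theorem chartSpeed_mul (H : IsDualFlow T φ ν) (hp : p ∈ chartSlab T x₀) :
    chartSpeed φ ν x₀ p * (‖inChart x₀ φ p‖ ^ n * gaussKronecker (stdBasis n)
      (fderivFst (inChart x₀ φ) p) (fderivFst (inChart x₀ ν) p)) =
      ⟪inChart x₀ φ p, inChart x₀ ν p⟫ ^ (n + 2) := by
  have hK := (H.gaussKronecker_pos hp).ne'
  have hr : ‖inChart x₀ φ p‖ ≠ 0 := norm_ne_zero_iff.2 ((H.convex p.2 hp.2).ne_zero _)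
  rw [chartSpeed]
  field

theorem contDiffOn_chartSpeed (H : IsDualFlow T φ ν) (x₀ : M) :
    ContDiffOn ℝ ∞ (chartSpeed φ ν x₀) (chartSlab T x₀) := by
  have hU := isOpen_extChartAt_target (I := 𝓡 (n - 1)) x₀
  have hmap := H.contDiffOn_map x₀
  have hnormal := H.contDiffOn_normal x₀
  have hne : ∀ p ∈ chartSlab T x₀, inChart x₀ φ p ≠ 0 := fun p hp =>
    (H.convex p.2 hp.2).ne_zero _
  have hK := contDiffOn_gaussKronecker (stdBasis n)
    (fun v => (contDiffOn_fderiv_slice hU (uniqueDiffOn_Ico 0 T) hmap (m := ∞) (by simp)).clm_apply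
      contDiffOn_const)
    (fun v => (contDiffOn_fderiv_slice hU (uniqueDiffOn_Ico 0 T) hnormal (m := ∞)
      (by simp)).clm_apply contDiffOn_const)
    (fun p hp => H.injective_fderivFst hp)
  exact (((hmap.inner ℝ hnormal).pow _).div ((hmap.norm ℝ hne).pow _) fun p hp =>
    pow_ne_zero _ (norm_ne_zero_iff.2 (hne p hp))).mul
      (contDiffOn_const.div hK fun p hp => (H.gaussKronecker_pos hp).ne')

theorem continuousOn_speed (H : IsDualFlow T φ ν) :
    ContinuousOn (fun p : M × ℝ => speed (fun y => φ y p.2) (fun y => ν y p.2) p.1)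
      (univ ×ˢ Ico 0 T) := by
  rintro ⟨x₀, t⟩ ⟨-, ht⟩
  have hcoord : ContinuousOn (fun p : M × ℝ => (extChartAt (𝓡 (n - 1)) x₀ p.1, p.2))
      ((extChartAt (𝓡 (n - 1)) x₀).source ×ˢ Ico 0 T) :=
    ((continuousOn_extChartAt x₀).comp continuousOn_fst fun p hp => hp.1).prodMk continuousOn_snd
  have hspeed : ContinuousOn (fun p : M × ℝ => speed (fun y => φ y p.2) (fun y => ν y p.2) p.1)
      ((extChartAt (𝓡 (n - 1)) x₀).source ×ˢ Ico 0 T) :=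
    ((H.contDiffOn_chartSpeed x₀).continuousOn.comp hcoord fun p hp =>
      mem_chartSlab hp.1 hp.2).congr fun p hp => H.speed_eq_chartSpeed hp.1 hp.2
  refine (hspeed (x₀, t) ⟨mem_extChartAt_source x₀, ht⟩).mono_of_mem_nhdsWithin ?_
  rw [nhdsWithin_prod_eq, nhdsWithin_univ]
  exact prod_mem_prod (extChartAt_source_mem_nhds x₀) self_mem_nhdsWithin

theorem continuousOn_chi (H : IsDualFlow T φ ν) (lam : ℝ) :
    ContinuousOn (fun p : M × ℝ => chi lam (fun y => φ y p.2) (fun y => ν y p.2) p.1)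
      (univ ×ˢ Ico 0 T) :=
  (H.smooth.continuousOn.norm.pow _).sub (continuousOn_const.mul H.continuousOn_speed)

theorem isNormalFlow (H : IsDualFlow T φ ν) (x₀ : M) :
    IsNormalFlow ((extChartAt (𝓡 (n - 1)) x₀).target ×ˢ Ioo 0 T) (inChart x₀ φ) (inChart x₀ ν)
      (chartSpeed φ ν x₀) := by
  have hmap : ∀ p ∈ (extChartAt (𝓡 (n - 1)) x₀).target ×ˢ Ioo 0 T,
      ContDiffAt ℝ 2 (inChart x₀ φ) p := fun p hp =>
    ((H.contDiffOn_map x₀).contDiffAt (chartSlab_mem_nhds hp)).of_le ENat.LEInfty.out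
  refine ⟨(isOpen_extChartAt_target x₀).prod isOpen_Ioo, hmap,
    fun p hp => ((H.contDiffOn_normal x₀).contDiffAt (chartSlab_mem_nhds hp)).of_le
      ENat.LEInfty.out,
    fun p hp => ((H.contDiffOn_chartSpeed x₀).contDiffAt (chartSlab_mem_nhds hp)).of_le
      ENat.LEInfty.out,
    fun p hp => (H.convex p.2 (prod_Ioo_subset_chartSlab hp).2).norm_normal _,
    fun p hp v => ?_, fun p hp => ?_⟩
  · rw [← fderivFst_apply ((hmap p hp).differentiableAt (by simp)),
      H.inner_fderivFst_normal (prod_Ioo_subset_chartSlab hp)]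
  · have hderiv := hasDerivAt_prodMk_right ((hmap p hp).differentiableAt (by simp)).hasFDerivAt
    obtain ⟨x, hx, t, ht, rfl⟩ := exists_eq_of_mem_chartSlab (prod_Ioo_subset_chartSlab hp)
    have hflow := (H.flow t ht x).hasDerivAt (Ico_mem_nhds hp.2.1 hp.2.2)
    rw [H.speed_eq_chartSpeed hx ht] at hflow
    simp only [inChart_apply φ hx] at hderiv
    rw [inChart_apply ν hx]
    exact hderiv.unique hflow

theorem eventually_norm_pow_le_of_chi_nonpos (H : IsDualFlow T φ ν) {lam : ℝ}
    (hp : p ∈ (extChartAt (𝓡 (n - 1)) x₀).target ×ˢ Ioo 0 T)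
    (hnonpos : ∀ t ∈ Icc 0 p.2, ∀ x, chi lam (fun y => φ y t) (fun y => ν y t) x ≤ 0) :
    ∀ᶠ q in 𝓝[{q | q.2 ≤ p.2}] p, ‖inChart x₀ φ q‖ ^ (n + 1) ≤ lam * chartSpeed φ ν x₀ q := by
  filter_upwards [nhdsWithin_le_nhds (chartSlab_mem_nhds hp), self_mem_nhdsWithin] with q hq hqt
  obtain ⟨x, hx, t, ht, rfl⟩ := exists_eq_of_mem_chartSlab hq
  have hchi := hnonpos t ⟨ht.1, hqt⟩ x
  rwa [H.chi_eq_inChart lam hx ht, sub_nonpos] at hchi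

theorem chi_ne_zero_of_forall_nonpos (H : IsDualFlow T φ ν) (hn : 2 ≤ n) {γ lam : ℝ}
    (hγ0 : 0 < γ) (hγ : ∀ t ∈ Ico 0 T, ∀ x, γ * ‖φ x t‖ ≤ ⟪φ x t, ν x t⟫)
    (hlam : sharpThreshold n γ ≤ lam) {t₀ : ℝ} (ht₀ : t₀ ∈ Ioo 0 T)
    (hnonpos : ∀ t ∈ Icc 0 t₀, ∀ x, chi lam (fun y => φ y t) (fun y => ν y t) x ≤ 0) (x₀ : M) :
    chi lam (fun y => φ y t₀) (fun y => ν y t₀) x₀ ≠ 0 := fun hzero => by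
  have hx₀ := mem_extChartAt_source (I := 𝓡 (n - 1)) x₀
  have htIco : t₀ ∈ Ico 0 T := Ioo_subset_Ico_self ht₀
  have hp := mem_chartSlab hx₀ htIco
  have hpW : (extChartAt (𝓡 (n - 1)) x₀ x₀, t₀) ∈
      (extChartAt (𝓡 (n - 1)) x₀).target ×ˢ Ioo 0 T := ⟨hp.1, ht₀⟩
  have hf0 : φ x₀ t₀ ≠ 0 := (H.convex t₀ htIco).ne_zero x₀
  have hlam0 : 0 < lam := by
    rw [chi, sub_eq_zero] at hzero
    exact pos_of_mul_pos_left (hzero ▸ pow_pos (norm_pos_iff.2 hf0) _)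
      (H.speed_pos htIco x₀).le
  have heq := hzero
  rw [H.chi_eq_inChart lam hx₀ htIco, sub_eq_zero] at heq
  have hle := H.eventually_norm_pow_le_of_chi_nonpos hpW hnonpos
  have : Nonempty (Fin (n - 1)) := ⟨⟨0, by lia⟩⟩
  have hlt := (H.isNormalFlow x₀).lt_sharpThreshold_of_norm_pow_le (γ := γ) (lam := lam) hpW
    (stdBasis n) (by simpa using H.finrank_eq hp) (H.injective_fderivFst hp)
    (fun v hv => H.inner_fderivFst_pos hp hv) (by rwa [inChart_apply φ hx₀])
    (fun q hq => by simpa using H.chartSpeed_mul (prod_Ioo_subset_chartSlab hq)) hγ0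
    (by rw [inChart_apply φ hx₀, inChart_apply ν hx₀]; exact hγ t₀ htIco x₀) hlam0
    (by simpa using heq) (by simpa using hle)
  rw [finrank_euclideanSpace_fin] at hlt
  exact hlam.not_gt hlt

theorem chi_neg [CompactSpace M] (H : IsDualFlow T φ ν) (hn : 2 ≤ n) {γ lam : ℝ} (hγ0 : 0 < γ)
    (hγ : ∀ t ∈ Ico 0 T, ∀ x, γ * ‖φ x t‖ ≤ ⟪φ x t, ν x t⟫) (hlam : sharpThreshold n γ ≤ lam)
    (hinit : ∀ x, chi lam (fun y => φ y 0) (fun y => ν y 0) x < 0) :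
    ∀ t ∈ Ico 0 T, ∀ x, chi lam (fun y => φ y t) (fun y => ν y t) x < 0 := by
  by_contra! hcross
  obtain ⟨t₀, ht₀, ⟨x₀, hzero⟩, hnonpos⟩ :=
    exists_first_zero (H.continuousOn_chi lam) hinit hcross
  exact H.chi_ne_zero_of_forall_nonpos hn hγ0 hγ hlam ht₀ hnonpos x₀ hzero

theorem norm_pow_le_of_chi_neg (H : IsDualFlow T φ ν) (ht : t ∈ Ico 0 T) {lam : ℝ}
    (hchi : chi lam (fun y => φ y t) (fun y => ν y t) x < 0) :
    ‖φ x t‖ ^ (n - 1) ≤ lam / gaussCurvature (fun y => φ y t) (fun y => ν y t) x := by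
  have hspeed := H.speed_pos ht x
  have hK := H.gaussCurvature_pos ht x
  have hr : 0 < ‖φ x t‖ := norm_pos_iff.2 ((H.convex t ht).ne_zero x)
  obtain ⟨k, rfl⟩ := Nat.exists_eq_add_one.2 ((H.convex t ht).dim_pos x)
  rw [chi, sub_neg] at hchi
  have hlam : 0 < lam := pos_of_mul_pos_left ((pow_pos hr _).trans hchi) hspeed.le
  have hsupport : ⟪φ x t, ν x t⟫ ^ (k + 1 + 2) / ‖φ x t‖ ^ (k + 1) ≤ ‖φ x t‖ ^ 2 := by
    rw [div_le_iff₀ (by positivity), ← pow_add, add_comm 2]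
    exact pow_le_pow_left₀ ((H.convex t ht).support_pos x).le
      ((H.convex t ht).support_le_norm x) _
  rw [Nat.add_sub_cancel]
  refine le_of_mul_le_mul_right ?_ (pow_pos hr 2)
  calc ‖φ x t‖ ^ k * ‖φ x t‖ ^ 2 = ‖φ x t‖ ^ (k + 1 + 1) := by ring
    _ ≤ lam * speed (fun y => φ y t) (fun y => ν y t) x := hchi.le
    _ ≤ lam * (‖φ x t‖ ^ 2 * (1 / gaussCurvature (fun y => φ y t) (fun y => ν y t) x)) := by
        rw [speed]
        gcongr
    _ = lam / gaussCurvature (fun y => φ y t) (fun y => ν y t) x * ‖φ x t‖ ^ 2 := by ring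

theorem exists_chi_neg [CompactSpace M] (H : IsDualFlow T φ ν) (ht : t ∈ Ico 0 T) (c : ℝ) :
    ∃ lam, c ≤ lam ∧ ∀ x, chi lam (fun y => φ y t) (fun y => ν y t) x < 0 := by
  have hspeed : Continuous fun x => speed (fun y => φ y t) (fun y => ν y t) x :=
    H.continuousOn_speed.comp_continuous (f := fun x => (x, t)) (Continuous.prodMk_left t)
      fun x => ⟨mem_univ x, ht⟩
  have hratio : Continuous fun x =>
      ‖φ x t‖ ^ (n + 1) / speed (fun y => φ y t) (fun y => ν y t) x :=
    ((H.convex t ht).smooth.continuous.norm.pow _).div hspeed fun x => (H.speed_pos ht x).ne'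
  obtain ⟨B, hB⟩ := (isCompact_range hratio).bddAbove
  refine ⟨max c (B + 1), le_max_left _ _, fun x => ?_⟩
  rw [chi, sub_neg, ← div_lt_iff₀ (H.speed_pos ht x)]
  exact (hB (mem_range_self x)).trans_lt ((lt_add_one B).trans_le (le_max_right _ _))

end IsDualFlow

end DualFlow

theorem mainTheorem3_general (n : ℕ) (hn : 2 ≤ n)
    {M : Type*} [TopologicalSpace M] [CompactSpace M]
    [ChartedSpace (EuclideanSpace ℝ (Fin (n - 1))) M] [IsManifold (𝓡 (n - 1)) ∞ M]
    (T : ℝ) (hT : 0 < T) (φ ν : M → ℝ → EuclideanSpace ℝ (Fin n))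
    (hflow : DualFlow.IsDualFlow T φ ν)
    (γ : ℝ) (hγ0 : 0 < γ)
    (hγ : ∀ t ∈ Set.Ico 0 T, ∀ x, γ * ‖φ x t‖ ≤ inner ℝ (φ x t) (ν x t))
    (c : ℝ) (hc : DualFlow.sharpThreshold n γ ≤ c) :
    (∃ lam : ℝ, c ≤ lam ∧
      (∀ x, DualFlow.chi lam (fun y => φ y 0) (fun y => ν y 0) x < 0) ∧
      ∀ t ∈ Set.Ico 0 T, ∀ x, ‖φ x t‖ ^ (n - 1) ≤
        lam / DualFlow.gaussCurvature (fun y => φ y t) (fun y => ν y t) x) ∧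
    (∀ lam : ℝ, c ≤ lam →
      (∀ x, DualFlow.chi lam (fun y => φ y 0) (fun y => ν y 0) x < 0) →
      ∀ t ∈ Set.Ico 0 T, ∀ x, ‖φ x t‖ ^ (n - 1) ≤
        lam / DualFlow.gaussCurvature (fun y => φ y t) (fun y => ν y t) x) := by
  have hbound : ∀ lam : ℝ, c ≤ lam →
      (∀ x, DualFlow.chi lam (fun y => φ y 0) (fun y => ν y 0) x < 0) →
      ∀ t ∈ Set.Ico 0 T, ∀ x, ‖φ x t‖ ^ (n - 1) ≤
        lam / DualFlow.gaussCurvature (fun y => φ y t) (fun y => ν y t) x :=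
    fun lam hlam hinit t ht x => hflow.norm_pow_le_of_chi_neg ht
      (hflow.chi_neg hn hγ0 hγ (hc.trans hlam) hinit t ht x)
  obtain ⟨lam, hlam, hinit⟩ := hflow.exists_chi_neg (left_mem_Ico.2 hT) c
  exact ⟨⟨lam, hlam, hinit, hbound lam hlam hinit⟩, hbound⟩

theorem mainTheorem3 (n : ℕ) (hn : 2 ≤ n)
    {M : Type*} [TopologicalSpace M] [CompactSpace M]
    [ChartedSpace (EuclideanSpace ℝ (Fin (n - 1))) M] [IsManifold (𝓡 (n - 1)) ∞ M]
    (T : ℝ) (hT : 0 < T) (φ ν : M → ℝ → EuclideanSpace ℝ (Fin n))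
    (hflow : DualFlow.IsDualFlow T φ ν)
    (γ : ℝ) (hγ0 : 0 < γ) (hγ1 : γ ≤ 1)
    (hγ : ∀ t ∈ Set.Ico 0 T, ∀ x, γ * ‖φ x t‖ ≤ inner ℝ (φ x t) (ν x t)) :
    (∃ lam : ℝ, DualFlow.threshold n γ ≤ lam ∧
      (∀ x, DualFlow.chi lam (fun y => φ y 0) (fun y => ν y 0) x < 0) ∧
      ∀ t ∈ Set.Ico 0 T, ∀ x, ‖φ x t‖ ^ (n - 1) ≤
        lam / DualFlow.gaussCurvature (fun y => φ y t) (fun y => ν y t) x) ∧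
    (∀ lam : ℝ, DualFlow.threshold n γ ≤ lam →
      (∀ x, DualFlow.chi lam (fun y => φ y 0) (fun y => ν y 0) x < 0) →
      ∀ t ∈ Set.Ico 0 T, ∀ x, ‖φ x t‖ ^ (n - 1) ≤
        lam / DualFlow.gaussCurvature (fun y => φ y t) (fun y => ν y t) x) :=
  mainTheorem3_general n hn T hT φ ν hflow γ hγ0 hγ _
    (DualFlow.sharpThreshold_le_threshold hn hγ0 hγ1)
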